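/- All graphs are finite and simple. An edge-colouring of a graph $G$ is \emph{monochromatic $k$-connected} if any two distinct vertices of $G$ are connected by $k$ distinct, pairwise internally vertex-disjoint paths, each of which is monochromatic (all of its edges have the same colour; different paths may have different colours). For a $k$-connected graph $G$, the \emph{monochromatic $k$-connection number} $mc_k(G)$ is the maximum number of colours used in a monochromatic $k$-connected edge-colouring of $G$. Let $K_{s,t}$ be the complete bipartite graph with classes of sizes $s$ and $t$. (a) Let $s,t,k$ be integers with $t\ge s\ge k\ge 2$. Then $$st-kt+1\le mc_k(K_{s,t})\le st-\left\lceil\frac{kt}{2}\right\rceil+1.$$ Moreover, if $s=k$ or $k\in\{2,3\}$, then $mc_k(K_{s,t})=st-kt+1$. (b) Let $t,k$ be integers with $t\ge k\ge 2$. Then $$t^2-kt+1\le mc_k(K_{t,t})\le t^2-\left\lceil\left(k-\frac12\right)t\right\rceil+1.$$ Moreover, if $k\in\{2,3,4,5\}$, then $mc_k(K_{t,t})=t^2-kt+1$. -/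

import Mathlib

namespace MonoConn

variable {V : Type*} {G : SimpleGraph V}

/-- All edges of the walk `p` have the same colour under the edge-colouring `φ`. -/
def IsMonochromatic {C : Type*} (φ : G.edgeSet → C) {u v : V} (p : G.Walk u v) : Prop :=
  ∃ c : C, ∀ (e : Sym2 V) (he : e ∈ p.edges), φ ⟨e, p.edges_subset_edgeSet he⟩ = c

/-- Two walks from `u` to `v` are internally vertex-disjoint: they meet only in the end-vertices. -/
def InternallyDisjoint {u v : V} (p q : G.Walk u v) : Prop :=
  ∀ w : V, w ∈ p.support → w ∈ q.support → w = u ∨ w = v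

/-- The edge-colouring `φ` is monochromatic `k`-connected: any two distinct vertices `u`, `v` are
connected by `k` distinct, pairwise internally vertex-disjoint monochromatic paths.
(Distinctness matters: a single edge `uv` is internally disjoint from itself, but counts once.) -/
def IsMonochromaticConnected {C : Type*} (k : ℕ) (φ : G.edgeSet → C) : Prop :=
  ∀ u v : V, u ≠ v →
    ∃ P : Fin k → G.Path u v, Function.Injective P ∧
      (∀ i, IsMonochromatic φ (P i : G.Walk u v)) ∧
      ∀ i j, i ≠ j → InternallyDisjoint (P i : G.Walk u v) (P j : G.Walk u v)

/-- The numbers `r` such that `G` has a monochromatic `k`-connected colouring using exactly `r`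
colours. -/
def colourNumbers (G : SimpleGraph V) (k : ℕ) : Set ℕ :=
  {r | ∃ φ : G.edgeSet → Fin r, Function.Surjective φ ∧ IsMonochromaticConnected k φ}

/-- The monochromatic `k`-connection number `mc_k(G)`: the maximum number of colours in a
monochromatic `k`-connected colouring of `G`. For a finite graph that has such a colouring the
supremum is a maximum, see `isGreatest_mc`. -/
noncomputable def mc (k : ℕ) (G : SimpleGraph V) : ℕ :=
  sSup (colourNumbers G k)

theorem isGreatest_mc [Finite V] (k : ℕ) (G : SimpleGraph V) (h : (colourNumbers G k).Nonempty) :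
    IsGreatest (colourNumbers G k) (mc k G) := by
  have hb : BddAbove (colourNumbers G k) := by
    refine ⟨Nat.card G.edgeSet, ?_⟩
    rintro r ⟨φ, hφ, -⟩
    simpa using Nat.card_le_card_of_surjective φ hφ
  exact ⟨Nat.sSup_mem h hb, fun r hr => le_csSup hb hr⟩

end MonoConn

/-! Lower bound: give one colour to a `k`-connected spanning subgraph `H` with at most `kt` edges
and every other edge its own colour. Here `H` joins residues modulo `s` that differ by one of `0, …,
k - 1`. Its connectivity follows from a sumset estimate for intervals and Menger's theorem, which is
itself derived from Hall's theorem.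

Upper bound: a colour with `e` edges wastes `e - 1` of them, so `r` colours waste `w = st - r` edges
in total. Let `X` be the class of size `t` and count paths over the ordered pairs of distinct
vertices of `X`. Each pair has `k` paths. A colour contributes at most the smaller of its two
degrees to a pair, hence at most `(|X| - 1) * e` altogether. Call a colour efficient if it
contributes more than `(|X| - 1) * (e - 1)`. With `m` efficient colours, `kt ≤ w + m`. Efficiency is
expensive: the colour must be regular on `X`, of degree at least 2, so it has at least `2t` edges
and `m * (2t - 1) ≤ w`. These two inequalities give the bounds, and the exact values for `k ≤ 3`.
For `s = t` and `3 ≤ k ≤ 5` the count is made on both classes: a colour efficient on both cannot be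
2-regular, so it has at least `3t` edges. For `s = k` all edges are forced to have one colour. -/

namespace MonoConn

open Finset

/-! ### Menger's theorem from Hall's marriage theorem -/

section DisjointPaths

open scoped Classical

variable {V : Type*} [Fintype V]

/-- The outer vertex boundary of `W`. -/
noncomputable def outerBoundary (H : SimpleGraph V) (W : Finset V) : Finset V :=
  {x | x ∉ W ∧ ∃ w ∈ W, H.Adj w x}

theorem mem_outerBoundary {H : SimpleGraph V} {W : Finset V} {x : V} :
    x ∈ outerBoundary H W ↔ x ∉ W ∧ ∃ w ∈ W, H.Adj w x := by
  simp [outerBoundary]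

/-- Allowed successors in the matching that encodes `n` disjoint `u`-`v` paths: `Sum.inr i` is the
`i`-th copy of `u` on the source side and the `i`-th copy of `v` on the target side. -/
noncomputable def successors (H : SimpleGraph V) (u v : V) (n : ℕ) :
    V ⊕ Fin n → Finset (V ⊕ Fin n)
  | .inl w => {z | z = .inl w ∨ (w ≠ u ∧ w ≠ v ∧
      Sum.elim (fun x => H.Adj w x ∧ x ≠ u ∧ x ≠ v) (fun _ => H.Adj w v) z)}
  | .inr _ => {z | Sum.elim (fun x => H.Adj u x ∧ x ≠ u ∧ x ≠ v) (fun _ => False) z}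

/-- Hall's condition. Without a source copy in `S`, letting every vertex stay put suffices. With
one, either some vertex of `S` reaches `v`, and all `n` sinks become available, or the boundary of
the part of `S` around `u` supplies `n` new vertices. -/
theorem exists_injective_successors {H : SimpleGraph V} {u v : V} (n : ℕ)
    (hadj : ¬ H.Adj u v) (huv : u ≠ v)
    (hcut : ∀ W : Finset V, u ∈ W → v ∉ W → (∀ w ∈ W, ¬ H.Adj w v) → n ≤ #(outerBoundary H W)) :
    ∃ f : V ⊕ Fin n → V ⊕ Fin n, Function.Injective f ∧ ∀ z, f z ∈ successors H u v n z := by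
  rw [← Finset.all_card_le_biUnion_card_iff_exists_injective]
  intro S
  have hself : ∀ w, (.inl w : V ⊕ Fin n) ∈ successors H u v n (.inl w) := by
    intro w; simp [successors]
  by_cases hS : ∃ i : Fin n, Sum.inr i ∈ S
  · obtain ⟨i, hi⟩ := hS
    have hle : #S ≤ #S.toLeft + n := by
      rw [← Finset.card_toLeft_add_card_toRight (u := S)]
      have := Finset.card_le_univ S.toRight
      simp at this ⊢
      exact this
    by_cases hv : ∃ w ∈ S.toLeft, w ≠ v ∧ w ≠ u ∧ H.Adj w v
    · obtain ⟨w, hw, hwv, hwu, hwadj⟩ := hv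
      refine hle.trans ?_
      have : S.toLeft.disjSum (univ : Finset (Fin n)) ⊆ S.biUnion (successors H u v n) := by
        intro z hz
        rw [Finset.mem_biUnion]
        rcases z with x | j
        · have hx : Sum.inl x ∈ S := by simpa using hz
          exact ⟨_, hx, hself x⟩
        · refine ⟨.inl w, by simpa using hw, ?_⟩
          simp [successors, hwv, hwu, hwadj]
      have h2 := Finset.card_le_card this
      simpa using h2
    · push Not at hv
      set W : Finset V := insert u (S.toLeft.filter fun w => w ≠ u ∧ w ≠ v) with hW
      have hb := hcut W (by simp [hW]) (by simp [hW, huv.symm]) (by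
        intro w hw
        rw [hW, Finset.mem_insert, Finset.mem_filter] at hw
        rcases hw with rfl | ⟨h1, h2, h3⟩
        · exact hadj
        · exact hv w h1 h3 h2)
      have hvB : v ∉ outerBoundary H W := by
        rw [mem_outerBoundary]
        rintro ⟨-, w, hw, hwv⟩
        rw [hW, Finset.mem_insert, Finset.mem_filter] at hw
        rcases hw with rfl | ⟨h1, h2, h3⟩
        · exact hadj hwv
        · exact hv w h1 h3 h2 hwv
      have hne : ∀ x ∈ outerBoundary H W, x ≠ u ∧ x ≠ v := by
        intro x hx
        refine ⟨?_, fun h => hvB (h ▸ hx)⟩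
        rintro rfl
        exact (mem_outerBoundary.1 hx).1 (by simp [hW])
      have hdisj : Disjoint S.toLeft (outerBoundary H W) := by
        rw [Finset.disjoint_left]
        intro x hx hxB
        exact (mem_outerBoundary.1 hxB).1 (by simp [hW, hne x hxB, Finset.mem_toLeft.1 hx])
      have hsub : (S.toLeft ∪ outerBoundary H W).map ⟨Sum.inl, Sum.inl_injective⟩ ⊆
          S.biUnion (successors H u v n) := by
        intro z hz
        rw [Finset.mem_map] at hz
        obtain ⟨x, hx, rfl⟩ := hz
        rw [Finset.mem_biUnion]
        rcases Finset.mem_union.1 hx with hx | hx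
        · exact ⟨.inl x, by simpa using hx, hself x⟩
        · obtain ⟨-, w, hw, hwx⟩ := mem_outerBoundary.1 hx
          obtain ⟨h1, h2⟩ := hne x hx
          rw [hW, Finset.mem_insert, Finset.mem_filter] at hw
          rcases hw with rfl | ⟨h3, h4, h5⟩
          · exact ⟨.inr i, hi, by simp [successors, hwx, h1, h2]⟩
          · exact ⟨.inl w, by simpa using h3, by simp [successors, hwx, h1, h2, h4, h5]⟩
      have h2 := Finset.card_le_card hsub
      rw [Finset.card_map, Finset.card_union_of_disjoint hdisj] at h2
      omega
  · push Not at hS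
    apply Finset.card_le_card
    intro z hz
    rcases z with x | j
    · exact Finset.mem_biUnion.2 ⟨_, hz, hself x⟩
    · exact absurd hz (hS j)

/-- The vertices met when iterating `f` from the `i`-th copy of the source. -/
inductive Orbit {n : ℕ} (f : V ⊕ Fin n → V ⊕ Fin n) (i : Fin n) : V → Prop
  | base {x : V} : f (.inr i) = .inl x → Orbit f i x
  | step {x y : V} : Orbit f i x → f (.inl x) = .inl y → Orbit f i y

-- Injectivity lets both orbits be traced back step by step to their sources.
omit [Fintype V] in
theorem Orbit.index_unique {n : ℕ} {f : V ⊕ Fin n → V ⊕ Fin n} (hf : Function.Injective f)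
    {i j : Fin n} {x : V} (hi : Orbit f i x) (hj : Orbit f j x) : i = j := by
  induction hi with
  | base h =>
    cases hj with
    | base h' => simpa using hf (h.trans h'.symm)
    | step _ h' => simpa using hf (h.trans h'.symm)
  | step _ h ih =>
    cases hj with
    | base h' => simpa using hf (h.trans h'.symm)
    | step hy h' =>
      have := hf (h.trans h'.symm)
      simp only [Sum.inl.injEq] at this
      subst this
      exact ih hy

/-- An orbit that never exits is a finite set mapped injectively, hence onto, itself by `f`. Then
`x₀` has a preimage in the orbit besides the source. -/
theorem Orbit.exists_exit {n : ℕ} {f : V ⊕ Fin n → V ⊕ Fin n} (hf : Function.Injective f)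
    {i : Fin n} {x₀ : V} (h₀ : f (.inr i) = .inl x₀) :
    ∃ x j, Orbit f i x ∧ f (.inl x) = .inr j := by
  by_contra! hcon
  have hstep : ∀ x : {x // Orbit f i x}, ∃ y : {x // Orbit f i x}, f (.inl x) = .inl y.1 := by
    rintro ⟨x, hx⟩
    rcases h : f (.inl x) with y | j
    · exact ⟨⟨y, hx.step h⟩, rfl⟩
    · exact absurd h (hcon x j hx)
  choose g hg using hstep
  have hginj : Function.Injective g := by
    intro a b hab
    have := hf ((hg a).trans ((congrArg _ (congrArg _ hab)).trans (hg b).symm))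
    exact Subtype.ext (by simpa using this)
  obtain ⟨y, hy⟩ := (Finite.injective_iff_surjective.1 hginj) ⟨x₀, Orbit.base h₀⟩
  have := hg y
  rw [hy] at this
  simpa using hf (this.trans h₀.symm)

/-- Menger's theorem for two non-adjacent vertices. -/
theorem exists_disjoint_paths {H : SimpleGraph V} {u v : V} (n : ℕ)
    (hadj : ¬ H.Adj u v) (huv : u ≠ v)
    (hcut : ∀ W : Finset V, u ∈ W → v ∉ W → (∀ w ∈ W, ¬ H.Adj w v) → n ≤ #(outerBoundary H W)) :
    ∃ P : Fin n → H.Path u v,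
      ∀ i j, i ≠ j → InternallyDisjoint (P i : H.Walk u v) (P j : H.Walk u v) := by
  obtain ⟨f, hf, hfs⟩ := exists_injective_successors n hadj huv hcut
  have hbase : ∀ i, ∃ x, f (.inr i) = .inl x ∧ H.Adj u x ∧ x ≠ u ∧ x ≠ v := by
    intro i
    have := hfs (.inr i)
    rcases h : f (.inr i) with x | j
    · rw [h] at this
      exact ⟨x, rfl, by simpa [successors] using this⟩
    · rw [h] at this
      simp [successors] at this
  have hstep : ∀ x y, f (.inl x) = .inl y → y = x ∨ H.Adj x y := by
    intro x y h
    have := hfs (.inl x)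
    rw [h] at this
    simp only [successors, mem_filter, mem_univ, Sum.inl.injEq, Sum.elim_inl, true_and] at this
    tauto
  have hexit : ∀ x j, f (.inl x) = .inr j → H.Adj x v := by
    intro x j h
    have := hfs (.inl x)
    rw [h] at this
    simp [successors] at this
    tauto
  have hwalk : ∀ i x, Orbit f i x →
      ∃ p : H.Walk u x, ∀ w ∈ p.support, w = u ∨ Orbit f i w := by
    intro i x hx
    induction hx with
    | base h =>
      obtain ⟨x', hx', ha, -⟩ := hbase i
      obtain rfl : x' = _ := by simpa using hx'.symm.trans h
      refine ⟨ha.toWalk, ?_⟩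
      intro w hw
      simp at hw
      rcases hw with rfl | rfl
      · exact Or.inl rfl
      · exact Or.inr (.base h)
    | @step x y hx h ih =>
      obtain ⟨p, hp⟩ := ih
      rcases hstep x y h with rfl | ha
      · exact ⟨p, hp⟩
      · refine ⟨p.concat ha, ?_⟩
        intro w hw
        rw [SimpleGraph.Walk.support_concat] at hw
        simp only [List.mem_append, List.mem_singleton] at hw
        rcases hw with hw | rfl
        · exact hp w hw
        · exact Or.inr (hx.step h)
  have hpath : ∀ i, ∃ P : H.Path u v, ∀ w ∈ (P : H.Walk u v).support,
      w = u ∨ w = v ∨ Orbit f i w := by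
    intro i
    obtain ⟨x₀, h₀, -⟩ := hbase i
    obtain ⟨x, j, hx, hj⟩ := Orbit.exists_exit hf h₀
    obtain ⟨p, hp⟩ := hwalk i x hx
    refine ⟨(p.concat (hexit x j hj)).toPath, ?_⟩
    intro w hw
    have hw := SimpleGraph.Walk.support_toPath_subset_support _ hw
    rw [SimpleGraph.Walk.support_concat] at hw
    simp only [List.mem_append, List.mem_singleton] at hw
    rcases hw with hw | rfl
    · rcases hp w hw with h | h
      · exact Or.inl h
      · exact Or.inr (Or.inr h)
    · exact Or.inr (Or.inl rfl)
  choose P hP using hpath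
  refine ⟨P, fun i j hij w hwi hwj => ?_⟩
  rcases hP i w hwi with h | h | h
  · exact Or.inl h
  · exact Or.inr h
  · rcases hP j w hwj with h' | h' | h'
    · exact Or.inl h'
    · exact Or.inr h'
    · exact absurd (h.index_unique hf h') hij

end DisjointPaths

/-! ### Colourings from expanding subgraphs -/

section LowerBound

open scoped Classical

variable {V : Type*} [Fintype V]

/-- If `uv` is an edge of `G`, it serves as one path and only `k - 1` further paths are needed, in
`H` without `uv`. Otherwise Menger's theorem applies to `H` directly. -/
theorem exists_disjoint_paths_through {G H : SimpleGraph V} (hHG : H ≤ G) {k : ℕ} (hk : 1 ≤ k)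
    (hdeg : ∀ v, k ≤ #{w | H.Adj v w})
    (hexp : ∀ W : Finset V, W.Nonempty → (∃ z, z ∉ W ∧ ∀ w ∈ W, ¬ H.Adj w z) →
      k ≤ #(outerBoundary H W)) {u v : V} (huv : u ≠ v) :
    ∃ P : Fin k → G.Path u v, Function.Injective P ∧
      (∀ i, (∀ e ∈ (P i : G.Walk u v).edges, e ∈ H.edgeSet) ∨
        ∀ e ∈ (P i : G.Walk u v).edges, e = s(u, v)) ∧
      ∀ i j, i ≠ j → InternallyDisjoint (P i : G.Walk u v) (P j : G.Walk u v) := by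
  have hsnd : ∀ p : G.Path u v, s(u, v) ∉ (p : G.Walk u v).edges →
      ∃ x ∈ (p : G.Walk u v).support, x ≠ u ∧ x ≠ v := by
    intro p hp
    have hnil : ¬ (p : G.Walk u v).Nil := SimpleGraph.Walk.not_nil_of_ne huv
    refine ⟨(p : G.Walk u v).snd, SimpleGraph.Walk.snd_mem_support_of_mem_edges _
      (SimpleGraph.Walk.mk_start_snd_mem_edges hnil), ?_, ?_⟩
    · exact ((p : G.Walk u v).adj_snd hnil).ne'
    · intro h
      have := SimpleGraph.Walk.mk_start_snd_mem_edges hnil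
      rw [h] at this
      exact hp this
  by_cases hadj : G.Adj u v
  · obtain ⟨n, rfl⟩ : ∃ n, k = n + 1 := ⟨k - 1, by omega⟩
    set H' := H.deleteEdges {s(u, v)} with hH'
    have hH'adj : ∀ x y, H'.Adj x y ↔ H.Adj x y ∧ s(x, y) ≠ s(u, v) := by
      intro x y; simp [hH', SimpleGraph.deleteEdges_adj]
    have hcut : ∀ W : Finset V, u ∈ W → v ∉ W → (∀ w ∈ W, ¬ H'.Adj w v) →
        n ≤ #(outerBoundary H' W) := by
      intro W hu hv hW
      -- Such a `z` makes the expansion of `H` applicable to `W`, and deleting `uv` costs only the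
      -- boundary vertex `v`. If there is none, all neighbours of `v` except possibly `u` lie in the
      -- boundary.
      by_cases hz : ∃ z, z ≠ u ∧ H.Adj v z ∧ z ∉ W ∧ ∀ w ∈ W, ¬ H'.Adj w z
      · obtain ⟨z, hzu, hvz, hzW, hz⟩ := hz
        have h1 := hexp W ⟨u, hu⟩ ⟨z, hzW, fun w hw hwz => hz w hw ((hH'adj _ _).2 ⟨hwz, by
          rw [Ne, Sym2.eq_iff]
          rintro (⟨-, h⟩ | ⟨-, h⟩)
          · exact hvz.ne h.symm
          · exact hzu h⟩)⟩
        have h2 : outerBoundary H W ⊆ insert v (outerBoundary H' W) := by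
          intro x hx
          obtain ⟨hxW, w, hw, hwx⟩ := mem_outerBoundary.1 hx
          rw [Finset.mem_insert]
          by_cases hxv : x = v
          · exact Or.inl hxv
          · refine Or.inr (mem_outerBoundary.2 ⟨hxW, w, hw, (hH'adj _ _).2 ⟨hwx, ?_⟩⟩)
            rw [Ne, Sym2.eq_iff]
            rintro (⟨-, h⟩ | ⟨-, h⟩)
            · exact hxv h
            · exact hxW (h ▸ hu)
        have h3 := (Finset.card_le_card h2).trans (Finset.card_insert_le _ _)
        omega
      · push Not at hz
        have h2 : ({w | H.Adj v w} : Finset V) ⊆ insert u (outerBoundary H' W) := by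
          intro x hx
          have hx : H.Adj v x := by simpa using hx
          rw [Finset.mem_insert]
          by_cases hxu : x = u
          · exact Or.inl hxu
          · refine Or.inr ?_
            have hxW : x ∉ W := fun hxW => hW x hxW ((hH'adj _ _).2 ⟨hx.symm, by
              rw [Ne, Sym2.eq_iff]
              rintro (⟨h, -⟩ | ⟨h, -⟩)
              · exact hxu h
              · exact hx.ne h.symm⟩)
            exact mem_outerBoundary.2 ⟨hxW, hz x hxu hx hxW⟩
        have h3 := (Finset.card_le_card h2).trans (Finset.card_insert_le _ _)
        have := hdeg v
        omega
    obtain ⟨Q, hQ⟩ := exists_disjoint_paths n (by simp [hH'adj]) huv hcut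
    have hle : H' ≤ G := (SimpleGraph.deleteEdges_le _).trans hHG
    have hQe : ∀ i, ∀ e ∈ (Q i : H'.Walk u v).edges, e ∈ H.edgeSet ∧ e ≠ s(u, v) := by
      intro i e he
      have := SimpleGraph.Walk.edges_subset_edgeSet _ he
      simpa [hH', SimpleGraph.edgeSet_deleteEdges] using this
    let R : Fin n → G.Path u v := fun i => ⟨(Q i : H'.Walk u v).mapLe hle, (Q i).2.mapLe hle⟩
    have hR : ∀ i, s(u, v) ∉ (R i : G.Walk u v).edges := by
      intro i he
      have : s(u, v) ∈ (Q i : H'.Walk u v).edges := by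
        simpa [R, SimpleGraph.Walk.edges_mapLe_eq_edges] using he
      exact (hQe i _ this).2 rfl
    have hRd : ∀ i j, i ≠ j → InternallyDisjoint (R i : G.Walk u v) (R j : G.Walk u v) := by
      intro i j hij w hwi hwj
      apply hQ i j hij w
      · simpa [R] using hwi
      · simpa [R] using hwj
    let e₀ : G.Path u v := SimpleGraph.Path.singleton hadj
    have he₀ : ∀ e ∈ (e₀ : G.Walk u v).edges, e = s(u, v) := by
      intro e he; simpa [e₀, SimpleGraph.Path.singleton] using he
    have he₀s : ∀ w ∈ (e₀ : G.Walk u v).support, w = u ∨ w = v := by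
      intro e he; simpa [e₀, SimpleGraph.Path.singleton] using he
    refine ⟨Fin.cons e₀ R, ?_, ?_, ?_⟩
    · rw [Fin.cons_injective_iff]
      constructor
      · rintro ⟨i, hi⟩
        apply hR i
        rw [hi]
        simp [e₀, SimpleGraph.Path.singleton]
      · intro i j hij
        by_contra hne
        obtain ⟨x, hx, hxu, hxv⟩ := hsnd (R i) (hR i)
        have := hRd i j hne x hx (hij ▸ hx)
        tauto
    · intro i
      refine Fin.cases ?_ (fun i => ?_) i
      · exact Or.inr he₀
      · refine Or.inl fun e he => (hQe i e ?_).1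
        simpa [R, SimpleGraph.Walk.edges_mapLe_eq_edges] using he
    · intro i j
      refine Fin.cases ?_ (fun i => ?_) i
      · intro _ w hw _
        exact he₀s w hw
      · refine Fin.cases ?_ (fun j => ?_) j
        · intro _ w _ hw
          exact he₀s w hw
        · intro hij
          exact hRd i j (fun h => hij (h ▸ rfl))
  · have hadj' : ¬ H.Adj u v := fun h => hadj (hHG h)
    obtain ⟨Q, hQ⟩ := exists_disjoint_paths k hadj' huv
      (fun W hu hv hW => hexp W ⟨u, hu⟩ ⟨v, hv, hW⟩)
    let R : Fin k → G.Path u v := fun i => ⟨(Q i : H.Walk u v).mapLe hHG, (Q i).2.mapLe hHG⟩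
    have hRd : ∀ i j, i ≠ j → InternallyDisjoint (R i : G.Walk u v) (R j : G.Walk u v) := by
      intro i j hij w hwi hwj
      apply hQ i j hij w
      · simpa [R] using hwi
      · simpa [R] using hwj
    refine ⟨R, ?_, ?_, hRd⟩
    · intro i j hij
      by_contra hne
      obtain ⟨x, hx, hxu, hxv⟩ := hsnd (R i)
        (fun h => hadj (SimpleGraph.Walk.adj_of_mem_edges _ h))
      have := hRd i j hne x hx (hij ▸ hx)
      tauto
    · intro i
      refine Or.inl fun e he => SimpleGraph.Walk.edges_subset_edgeSet (Q i : H.Walk u v) ?_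
      simpa [R, SimpleGraph.Walk.edges_mapLe_eq_edges] using he

/-- Colour 0 is used on `H`, a private colour on each other edge. A path inside `H` or consisting of
the edge `uv` alone is then monochromatic. -/
theorem mem_colourNumbers_of_expanding {G H : SimpleGraph V} [Nonempty V] (hHG : H ≤ G) {k : ℕ}
    (hk : 1 ≤ k) (hdeg : ∀ v, k ≤ #{w | H.Adj v w})
    (hexp : ∀ W : Finset V, W.Nonempty → (∃ z, z ∉ W ∧ ∀ w ∈ W, ¬ H.Adj w z) →
      k ≤ #(outerBoundary H W)) :
    #G.edgeFinset - #H.edgeFinset + 1 ∈ colourNumbers G k := by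
  have hcard : Fintype.card {e : G.edgeSet // e.1 ∉ H.edgeSet} =
      #G.edgeFinset - #H.edgeFinset := by
    rw [← Finset.card_sdiff_of_subset (SimpleGraph.edgeFinset_mono hHG), Fintype.card_subtype]
    refine Finset.card_bij (fun e _ => e.1) ?_ ?_ ?_
    · rintro ⟨e, he⟩ h
      simp only [mem_filter, mem_univ, true_and] at h
      simpa [he] using h
    · rintro a - b - h
      exact Subtype.ext h
    · intro e he
      simp only [mem_sdiff, SimpleGraph.mem_edgeFinset] at he
      exact ⟨⟨e, he.1⟩, by simpa using he.2, rfl⟩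
  set r := #G.edgeFinset - #H.edgeFinset
  let F : {e : G.edgeSet // e.1 ∉ H.edgeSet} ≃ Fin r := Fintype.equivFinOfCardEq hcard
  let φ : G.edgeSet → Fin (r + 1) := fun e =>
    if he : e.1 ∈ H.edgeSet then 0 else (F ⟨e, he⟩).succ
  refine ⟨φ, ?_, ?_⟩
  · intro c
    refine Fin.cases ?_ (fun c => ?_) c
    · obtain ⟨v⟩ := ‹Nonempty V›
      obtain ⟨w, hw⟩ := Finset.card_pos.1 (hk.trans (hdeg v))
      have hw : H.Adj v w := by simpa using hw
      exact ⟨⟨s(v, w), hHG hw⟩, by simp [φ, hw]⟩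
    · obtain ⟨e, he⟩ := F.surjective c
      refine ⟨e.1, ?_⟩
      simp only [φ, dif_neg e.2]
      rw [← he]
  · intro u v huv
    obtain ⟨P, hinj, hP, hd⟩ := exists_disjoint_paths_through hHG hk hdeg hexp huv
    refine ⟨P, hinj, fun i => ?_, hd⟩
    rcases hP i with h | h
    · exact ⟨0, fun e he => by simp only [φ]; rw [dif_pos (h e he)]⟩
    · by_cases hadj : s(u, v) ∈ G.edgeSet
      · refine ⟨φ ⟨s(u, v), hadj⟩, fun e he => ?_⟩
        congr 1
        exact Subtype.ext (h e he)
      · refine ⟨0, fun e he => absurd (SimpleGraph.Walk.edges_subset_edgeSet _ he) ?_⟩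
        rw [h e he]
        exact hadj

end LowerBound

/-! ### A sparse expanding bipartite graph -/

section Circulant

open scoped Classical Pointwise

variable {s : ℕ} [NeZero s]

/-- The residues `0, …, k - 1` modulo `s`. -/
def initialResidues (s k : ℕ) : Finset (ZMod s) :=
  (range k).image fun i : ℕ => (i : ZMod s)

omit [NeZero s] in
theorem card_initialResidues {k : ℕ} (hk : k ≤ s) : #(initialResidues s k) = k := by
  rw [initialResidues, Finset.card_image_of_injOn, card_range]
  intro i hi j hj hij
  simp only [coe_range, Set.mem_Iio] at hi hj
  have := (ZMod.natCast_eq_natCast_iff' _ _ _).1 hij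
  rwa [Nat.mod_eq_of_lt (hi.trans_le hk), Nat.mod_eq_of_lt (hj.trans_le hk)] at this

theorem ZMod.eq_univ_of_forall_add_one_mem {Y : Finset (ZMod s)} (hne : Y.Nonempty)
    (h : ∀ y ∈ Y, y + 1 ∈ Y) : Y = univ := by
  obtain ⟨y, hy⟩ := hne
  have hn : ∀ n : ℕ, y + n ∈ Y := by
    intro n
    induction n with
    | zero => simpa using hy
    | succ n ih => simpa [add_assoc] using h _ ih
  ext z
  simpa using hn (z - y).val

/-- Lengthening the interval by one residue adds a new element, since a nonempty proper subset of
`ZMod s` is not closed under adding 1. Primality of `s` plays no role. -/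
theorem card_add_initialResidues {P : Finset (ZMod s)} (hP : P.Nonempty) {k : ℕ} (hk : 1 ≤ k)
    (h : P + initialResidues s k ≠ univ) : #P + k ≤ #(P + initialResidues s k) + 1 := by
  induction k, hk using Nat.le_induction with
  | base => simp [initialResidues]
  | succ k hk ih =>
    have hsub : P + initialResidues s k ⊆ P + initialResidues s (k + 1) :=
      Finset.add_subset_add_left (Finset.image_subset_image (range_mono (Nat.le_succ k)))
    have hne : (P + initialResidues s k).Nonempty :=
      hP.add ((Finset.nonempty_range_iff.2 (by omega)).image _)
    have hY : P + initialResidues s k ≠ univ := fun hu => h (univ_subset_iff.1 (hu ▸ hsub))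
    obtain ⟨y, hy, hy1⟩ : ∃ y ∈ P + initialResidues s k, y + 1 ∉ P + initialResidues s k := by
      by_contra! hcon
      exact hY (ZMod.eq_univ_of_forall_add_one_mem hne hcon)
    have hy2 : y + 1 ∈ P + initialResidues s (k + 1) := by
      obtain ⟨p, hp, i, hi, rfl⟩ := Finset.mem_add.1 hy
      obtain ⟨i, hi', rfl⟩ := Finset.mem_image.1 hi
      refine Finset.mem_add.2 ⟨p, hp, ((i + 1 : ℕ) : ZMod s), Finset.mem_image.2 ⟨i + 1, ?_, rfl⟩, ?_⟩
      · simpa using hi'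
      · push_cast; ring
    have := Finset.card_lt_card (Finset.ssubset_iff_of_subset hsub |>.2 ⟨_, hy2, hy1⟩)
    have := ih hY
    omega

theorem card_sub_initialResidues {P : Finset (ZMod s)} (hP : P.Nonempty) {k : ℕ} (hk : 1 ≤ k)
    (h : P - initialResidues s k ≠ univ) : #P + k ≤ #(P - initialResidues s k) + 1 := by
  have heq : -P + initialResidues s k = -(P - initialResidues s k) := by
    rw [neg_sub, sub_eq_add_neg, add_comm]
  have := card_add_initialResidues (P := -P) hP.neg hk (by
    rw [heq]
    intro hu
    apply h
    rw [← neg_neg (P - initialResidues s k), hu]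
    ext x; simp)
  rwa [heq, Finset.card_neg, Finset.card_neg] at this

variable {A B : Type*}

/-- The bipartite graph in which `a` and `b` are adjacent when `π b - α a` is one of the residues
`0, …, k - 1`. -/
def circulantBipartite (α : A → ZMod s) (π : B → ZMod s) (k : ℕ) : SimpleGraph (A ⊕ B) where
  Adj
    | .inl a, .inr b => π b - α a ∈ initialResidues s k
    | .inr b, .inl a => π b - α a ∈ initialResidues s k
    | _, _ => False
  symm := ⟨by rintro (a | b) (a' | b') h <;> exact h⟩
  loopless := ⟨by rintro (a | b) h <;> exact h⟩

omit [NeZero s] in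
theorem circulantBipartite_le (α : A → ZMod s) (π : B → ZMod s) (k : ℕ) :
    circulantBipartite α π k ≤ completeBipartiteGraph A B := by
  rintro (a | b) (a' | b') h
  · exact h.elim
  · simp
  · simp
  · exact h.elim

variable [Fintype A] [Fintype B]

omit [NeZero s] in
theorem card_edgeFinset_circulantBipartite_le (α : A ≃ ZMod s) (π : B → ZMod s) {k : ℕ}
    (hk : k ≤ s) : #(circulantBipartite α π k).edgeFinset ≤ k * Fintype.card B := by
  have hsub : (circulantBipartite α π k).edgeFinset ⊆
      (initialResidues s k ×ˢ (univ : Finset B)).image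
        fun x => s(Sum.inl (α.symm (π x.2 - x.1)), Sum.inr x.2) := by
    intro e he
    rw [SimpleGraph.mem_edgeFinset] at he
    rw [Finset.mem_image]
    induction e using Sym2.ind with
    | _ x y =>
      rcases x with a | b <;> rcases y with a' | b'
      · exact he.elim
      · exact ⟨(π b' - α a, b'), by simpa using (show π b' - α a ∈ _ from he), by simp⟩
      · exact ⟨(π b - α a', b), by simpa using (show π b - α a' ∈ _ from he), by simp [Sym2.eq_swap]⟩
      · exact he.elim
  have := (Finset.card_le_card hsub).trans Finset.card_image_le
  rwa [Finset.card_product, card_initialResidues hk, Finset.card_univ] at this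

omit [NeZero s] in
theorem le_degree_circulantBipartite (α : A ≃ ZMod s) {π : B → ZMod s}
    (hπ : Function.Surjective π) {k : ℕ} (hk : k ≤ s) (v : A ⊕ B) :
    k ≤ #{w | (circulantBipartite α π k).Adj v w} := by
  obtain ⟨σ, hσ⟩ := hπ.hasRightInverse
  refine (card_initialResidues hk).ge.trans ?_
  rcases v with a | b
  · refine Finset.card_le_card_of_injOn (fun i => .inr (σ (i + α a))) ?_ ?_
    · intro i hi
      rw [mem_coe, mem_filter]
      refine ⟨mem_univ _, ?_⟩
      change π _ - α _ ∈ _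
      simpa [hσ _] using hi
    · intro i _ j _ hij
      simpa using hσ.injective (Sum.inr_injective hij)
  · refine Finset.card_le_card_of_injOn (fun i => .inl (α.symm (π b - i))) ?_ ?_
    · intro i hi
      rw [mem_coe, mem_filter]
      refine ⟨mem_univ _, ?_⟩
      change π _ - α _ ∈ _
      simpa using hi
    · intro i _ j _ hij
      simpa using hij

/-- If `u` has no neighbour in `W`, its whole neighbourhood is boundary; the same holds for `z` if
all its neighbours are adjacent to `W`. Otherwise `W` meets both classes and dominates neither, so
each class contributes at least `k - 1` boundary vertices by the sumset estimate, and `2(k - 1) ≥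
k`. -/
theorem le_card_outerBoundary_circulantBipartite (α : A ≃ ZMod s) {π : B → ZMod s}
    (hπ : Function.Surjective π) {k : ℕ} (hk2 : 2 ≤ k) (hk : k ≤ s) (W : Finset (A ⊕ B))
    (hW : W.Nonempty) (hz : ∃ z, z ∉ W ∧ ∀ w ∈ W, ¬ (circulantBipartite α π k).Adj w z) :
    k ≤ #(outerBoundary (circulantBipartite α π k) W) := by
  obtain ⟨σ, hσ⟩ := hπ.hasRightInverse
  set H := circulantBipartite α π k with hH
  obtain ⟨u, hu⟩ := hW
  obtain ⟨z, hzW, hz⟩ := hz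
  by_cases hu' : ∃ u' ∈ W, H.Adj u u'
  swap
  · push Not at hu'
    refine (le_degree_circulantBipartite α hπ hk u).trans (Finset.card_le_card fun x hx => ?_)
    have hx : H.Adj u x := by simpa using hx
    exact mem_outerBoundary.2 ⟨fun hxW => hu' x hxW hx, u, hu, hx⟩
  by_cases hz' : ∃ z' ∉ W, H.Adj z z' ∧ ∀ w ∈ W, ¬ H.Adj w z'
  swap
  · push Not at hz'
    refine (le_degree_circulantBipartite α hπ hk z).trans (Finset.card_le_card fun x hx => ?_)
    have hx : H.Adj z x := by simpa using hx
    have hxW : x ∉ W := fun hxW => hz x hxW hx.symm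
    exact mem_outerBoundary.2 ⟨hxW, hz' x hxW hx⟩
  obtain ⟨u', hu'W, huu'⟩ := hu'
  obtain ⟨z', hz'W, hzz', hz'⟩ := hz'
  obtain ⟨a₀, b₀, ha₀, hb₀⟩ : ∃ a b, Sum.inl a ∈ W ∧ Sum.inr b ∈ W := by
    rcases u with a | b <;> rcases u' with a' | b'
    · exact huu'.elim
    · exact ⟨_, _, hu, hu'W⟩
    · exact ⟨_, _, hu'W, hu⟩
    · exact huu'.elim
  obtain ⟨a₁, b₁, ha₁, hb₁⟩ : ∃ a b, (∀ w ∈ W, ¬ H.Adj w (Sum.inl a)) ∧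
      ∀ w ∈ W, ¬ H.Adj w (Sum.inr b) := by
    rcases z with a | b <;> rcases z' with a' | b'
    · exact hzz'.elim
    · exact ⟨_, _, hz, hz'⟩
    · exact ⟨_, _, hz', hz⟩
    · exact hzz'.elim
  set I := initialResidues s k with hI
  set P := W.toLeft.image α with hP
  set Q := W.toRight.image π with hQ
  have hPI : P + I ≠ univ := by
    intro h
    have : π b₁ ∈ P + I := h ▸ mem_univ _
    obtain ⟨p, hp, i, hi, hpi⟩ := Finset.mem_add.1 this
    obtain ⟨a, ha, rfl⟩ := Finset.mem_image.1 hp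
    refine hb₁ (.inl a) (by simpa using ha) ?_
    change π b₁ - α a ∈ I
    rw [← hpi]; simpa using hi
  have hQI : Q - I ≠ univ := by
    intro h
    have : α a₁ ∈ Q - I := h ▸ mem_univ _
    obtain ⟨q, hq, i, hi, hqi⟩ := Finset.mem_sub.1 this
    obtain ⟨b, hb, rfl⟩ := Finset.mem_image.1 hq
    refine ha₁ (.inr b) (by simpa using hb) ?_
    change π b - α a₁ ∈ I
    rw [← hqi]; simpa using hi
  have h1 : #P + k ≤ #(P + I) + 1 := card_add_initialResidues (P := P) ⟨α a₀, by simp [hP, ha₀]⟩ (by omega) hPI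
  have h2 : #Q + k ≤ #(Q - I) + 1 := card_sub_initialResidues (P := Q)
    ⟨π b₀, Finset.mem_image_of_mem _ (by simpa using hb₀)⟩ (by omega) hQI
  -- The section `σ` picks one vertex over each residue; a residue outside `Q` has no vertex of `W`
  -- over it.
  have hsub : (((Q - I) \ P).image α.symm).disjSum (((P + I) \ Q).image σ) ⊆
      outerBoundary H W := by
    intro x hx
    rcases x with a | b
    · simp only [Finset.inl_mem_disjSum, Finset.mem_image, Finset.mem_sdiff] at hx
      obtain ⟨y, ⟨hy, hyP⟩, rfl⟩ := hx
      obtain ⟨q, hq, i, hi, rfl⟩ := Finset.mem_sub.1 hy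
      obtain ⟨b, hb, rfl⟩ := Finset.mem_image.1 hq
      refine mem_outerBoundary.2 ⟨fun h => hyP ?_, .inr b, by simpa using hb, ?_⟩
      · exact Finset.mem_image.2 ⟨_, by simpa using h, by simp⟩
      · change π b - α _ ∈ I
        simpa using hi
    · simp only [Finset.inr_mem_disjSum, Finset.mem_image, Finset.mem_sdiff] at hx
      obtain ⟨y, ⟨hy, hyQ⟩, rfl⟩ := hx
      obtain ⟨p, hp, i, hi, rfl⟩ := Finset.mem_add.1 hy
      obtain ⟨a, ha, rfl⟩ := Finset.mem_image.1 hp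
      refine mem_outerBoundary.2 ⟨fun h => hyQ ?_, .inl a, by simpa using ha, ?_⟩
      · exact Finset.mem_image.2 ⟨_, by simpa using h, hσ _⟩
      · change π _ - α _ ∈ I
        rw [hσ]
        simpa using hi
  have h3 := Finset.card_le_card hsub
  rw [Finset.card_disjSum, Finset.card_image_of_injective _ α.symm.injective,
    Finset.card_image_of_injective _ hσ.injective] at h3
  have h4 := Finset.le_card_sdiff P (Q - I)
  have h5 := Finset.le_card_sdiff Q (P + I)
  omega

omit [Fintype A] [Fintype B] in
theorem card_edgeFinset_completeBipartiteGraph_fin (s t : ℕ) :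
    #(completeBipartiteGraph (Fin s) (Fin t)).edgeFinset = s * t := by
  have := SimpleGraph.encard_edgeSet_completeBipartiteGraph (W₁ := Fin s) (W₂ := Fin t)
  rw [← SimpleGraph.coe_edgeFinset, Set.encard_coe_eq_coe_finsetCard] at this
  simp only [ENat.card_eq_coe_fintype_card, Fintype.card_fin] at this
  exact_mod_cast this

omit [NeZero s] in
/-- A colour number of `K_{s,t}` that attains the lower bound. -/
theorem exists_colourNumber_completeBipartiteGraph {s t k : ℕ} (hk2 : 2 ≤ k) (hks : k ≤ s)
    (hst : s ≤ t) :
    ∃ r ∈ colourNumbers (completeBipartiteGraph (Fin s) (Fin t)) k, s * t + 1 ≤ r + k * t := by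
  have : NeZero s := ⟨by omega⟩
  have hπ : Function.Surjective fun b : Fin t => ((b : ℕ) : ZMod s) := by
    intro x
    exact ⟨⟨x.val, (ZMod.val_lt x).trans_le hst⟩, by simp⟩
  let α : Fin s ≃ ZMod s := (ZMod.finEquiv s).toEquiv
  have : Nonempty (Fin s ⊕ Fin t) := ⟨.inl ⟨0, by omega⟩⟩
  refine ⟨_, mem_colourNumbers_of_expanding (circulantBipartite_le α (fun b : Fin t => ((b : ℕ) : ZMod s)) k) (by omega)
    (le_degree_circulantBipartite α hπ hks)
    (le_card_outerBoundary_circulantBipartite α hπ hk2 hks), ?_⟩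
  have h := card_edgeFinset_circulantBipartite_le α (fun b : Fin t => ((b : ℕ) : ZMod s)) hks
  rw [card_edgeFinset_completeBipartiteGraph_fin]
  rw [Fintype.card_fin] at h
  omega

end Circulant

/-! ### Disjoint paths within colour classes -/

section ColourClasses

open scoped Classical

variable {V C : Type*} {G : SimpleGraph V}

/-- The spanning subgraph of the edges of colour `c`. -/
def colourGraph (φ : G.edgeSet → C) (c : C) : SimpleGraph V where
  Adj u v := ∃ h : G.Adj u v, φ ⟨s(u, v), h⟩ = c
  symm := ⟨by
    rintro u v ⟨h, hc⟩
    refine ⟨h.symm, ?_⟩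
    rw [← hc]
    congr 1
    exact Subtype.ext Sym2.eq_swap⟩
  loopless := ⟨by rintro u ⟨h, -⟩; exact h.ne rfl⟩

theorem colourGraph_le (φ : G.edgeSet → C) (c : C) : colourGraph φ c ≤ G := fun _ _ h => h.1

theorem mem_edgeSet_colourGraph {φ : G.edgeSet → C} {c : C} {e : Sym2 V} :
    e ∈ (colourGraph φ c).edgeSet ↔ ∃ h : e ∈ G.edgeSet, φ ⟨e, h⟩ = c := by
  induction e using Sym2.ind with
  | _ x y => rfl

theorem colour_unique {φ : G.edgeSet → C} {c c' : C} {u v : V} (h : (colourGraph φ c).Adj u v)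
    (h' : (colourGraph φ c').Adj u v) : c = c' := h.2.symm.trans h'.2

/-- A system of `k` internally disjoint monochromatic paths, sorted into colour classes. -/
structure PathSystem (φ : G.edgeSet → C) (k : ℕ) (u v : V) where
  colour : Fin k → C
  path : ∀ i, (colourGraph φ (colour i)).Path u v
  disjoint : ∀ i j, i ≠ j → ∀ w ∈ (path i : (colourGraph φ (colour i)).Walk u v).support,
    w ∈ (path j : (colourGraph φ (colour j)).Walk u v).support → w = u ∨ w = v

/-- Injectivity need not be recorded: between non-adjacent ends every path has an internal vertex,
so disjointness keeps the paths distinct. -/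
theorem IsMonochromaticConnected.nonempty_pathSystem {φ : G.edgeSet → C} {k : ℕ}
    (h : IsMonochromaticConnected k φ) {u v : V} (huv : u ≠ v) : Nonempty (PathSystem φ k u v) := by
  obtain ⟨P, -, hmono, hd⟩ := h u v huv
  choose χ hχ using hmono
  have he : ∀ i, ∀ e ∈ (P i : G.Walk u v).edges, e ∈ (colourGraph φ (χ i)).edgeSet :=
    fun i e he => mem_edgeSet_colourGraph.2 ⟨_, hχ i e he⟩
  refine ⟨⟨χ, fun i => ⟨(P i : G.Walk u v).transfer _ (he i), (P i).2.transfer _⟩, ?_⟩⟩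
  intro i j hij w hi hj
  simp only [SimpleGraph.Walk.support_transfer] at hi hj
  exact hd i j hij w hi hj

namespace PathSystem

variable {φ : G.edgeSet → C} {k : ℕ} {u v : V} (S : PathSystem φ k u v)

/-- The second vertex of the `i`-th path. -/
def snd (i : Fin k) : V := (S.path i : (colourGraph φ (S.colour i)).Walk u v).snd

/-- The last but one vertex of the `i`-th path. -/
def penultimate (i : Fin k) : V := (S.path i : (colourGraph φ (S.colour i)).Walk u v).penultimate

theorem adj_snd (huv : u ≠ v) (i : Fin k) : (colourGraph φ (S.colour i)).Adj u (S.snd i) :=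
  SimpleGraph.Walk.adj_snd (SimpleGraph.Walk.not_nil_of_ne huv)

theorem adj_penultimate (huv : u ≠ v) (i : Fin k) :
    (colourGraph φ (S.colour i)).Adj (S.penultimate i) v :=
  SimpleGraph.Walk.adj_penultimate (SimpleGraph.Walk.not_nil_of_ne huv)

theorem snd_mem (i : Fin k) :
    S.snd i ∈ (S.path i : (colourGraph φ (S.colour i)).Walk u v).support :=
  SimpleGraph.Walk.getVert_mem_support _ _

theorem penultimate_mem (i : Fin k) :
    S.penultimate i ∈ (S.path i : (colourGraph φ (S.colour i)).Walk u v).support :=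
  SimpleGraph.Walk.getVert_mem_support _ _

theorem snd_ne (huv : u ≠ v) (hadj : ¬ G.Adj u v) (i : Fin k) : S.snd i ≠ u ∧ S.snd i ≠ v :=
  ⟨(S.adj_snd huv i).ne', fun h => hadj (h ▸ colourGraph_le _ _ (S.adj_snd huv i))⟩

theorem penultimate_ne (huv : u ≠ v) (hadj : ¬ G.Adj u v) (i : Fin k) :
    S.penultimate i ≠ u ∧ S.penultimate i ≠ v :=
  ⟨fun h => hadj (h ▸ colourGraph_le _ _ (S.adj_penultimate huv i)),
    (S.adj_penultimate huv i).ne⟩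

theorem eq_of_snd_mem (huv : u ≠ v) (hadj : ¬ G.Adj u v) {i j : Fin k}
    (h : S.snd i ∈ (S.path j : (colourGraph φ (S.colour j)).Walk u v).support) : i = j := by
  by_contra hij
  have := S.disjoint i j hij _ (S.snd_mem i) h
  have := S.snd_ne huv hadj i
  tauto

theorem eq_of_penultimate_mem (huv : u ≠ v) (hadj : ¬ G.Adj u v) {i j : Fin k}
    (h : S.penultimate i ∈ (S.path j : (colourGraph φ (S.colour j)).Walk u v).support) :
    i = j := by
  by_contra hij
  have := S.disjoint i j hij _ (S.penultimate_mem i) h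
  have := S.penultimate_ne huv hadj i
  tauto

theorem snd_injective (huv : u ≠ v) (hadj : ¬ G.Adj u v) : Function.Injective S.snd :=
  fun _ j hij => S.eq_of_snd_mem huv hadj (hij ▸ S.snd_mem j)

theorem penultimate_injective (huv : u ≠ v) (hadj : ¬ G.Adj u v) :
    Function.Injective S.penultimate :=
  fun _ j hij => S.eq_of_penultimate_mem huv hadj (hij ▸ S.penultimate_mem j)

/-- The number of paths of colour `c`. -/
noncomputable def count (c : C) : ℕ := #{i | S.colour i = c}

theorem sum_count [Fintype C] : ∑ c, S.count c = k := by
  have := Finset.card_eq_sum_card_fiberwise (f := S.colour) (s := univ) (t := univ) (by simp)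
  simpa [count] using this.symm

theorem count_le_degree_left [Fintype V] (huv : u ≠ v) (hadj : ¬ G.Adj u v) (c : C) :
    S.count c ≤ (colourGraph φ c).degree u := by
  rw [← SimpleGraph.card_neighborFinset_eq_degree]
  refine Finset.card_le_card_of_injOn S.snd ?_ ((S.snd_injective huv hadj).injOn)
  intro i hi
  obtain rfl : S.colour i = c := by simpa using hi
  simpa using S.adj_snd huv i

theorem count_le_degree_right [Fintype V] (huv : u ≠ v) (hadj : ¬ G.Adj u v) (c : C) :
    S.count c ≤ (colourGraph φ c).degree v := by
  rw [← SimpleGraph.card_neighborFinset_eq_degree]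
  refine Finset.card_le_card_of_injOn S.penultimate ?_ ((S.penultimate_injective huv hadj).injOn)
  intro i hi
  obtain rfl : S.colour i = c := by simpa using hi
  simpa using (S.adj_penultimate huv i).symm

theorem reachable_of_count_pos {c : C} (hc : 0 < S.count c) : (colourGraph φ c).Reachable u v := by
  obtain ⟨i, hi⟩ := Finset.card_pos.1 hc
  obtain rfl : S.colour i = c := by simpa using hi
  exact ⟨(S.path i).1⟩

end PathSystem

/-- An internal vertex of the path already has two neighbours on it, and degree two leaves no room
for another. -/
theorem mem_support_of_adj_of_isPath [Fintype V] {H : SimpleGraph V} (hdeg : ∀ w, H.degree w ≤ 2)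
    {u v : V} {p : H.Walk u v} (hp : p.IsPath) {w x : V} (hw : w ∈ p.support) (hwu : w ≠ u)
    (hwv : w ≠ v) (hwx : H.Adj w x) : x ∈ p.support := by
  obtain ⟨i, rfl, hi⟩ := SimpleGraph.Walk.mem_support_iff_exists_getVert.1 hw
  have hi0 : i ≠ 0 := by rintro rfl; simp at hwu
  have hil : i < p.length := by
    refine lt_of_le_of_ne hi ?_
    rintro rfl
    simp at hwv
  have h2 := hp.ncard_neighborSet_toSubgraph_internal_eq_two hi0 hil
  have hsub := p.toSubgraph.neighborSet_subset (p.getVert i)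
  have hcard : (H.neighborSet (p.getVert i)).ncard ≤ 2 := by
    rw [← SimpleGraph.coe_neighborFinset, Set.ncard_coe_finset]
    exact hdeg _
  have heq := Set.eq_of_subset_of_ncard_le hsub (by omega)
  have hx : x ∈ p.toSubgraph.neighborSet (p.getVert i) := by rw [heq]; exact hwx
  rw [← SimpleGraph.Walk.mem_verts_toSubgraph]
  exact SimpleGraph.Subgraph.Adj.snd_mem hx

theorem eq_or_eq_of_degree_le_two [Fintype V] {H : SimpleGraph V} {w x y z : V}
    (hdeg : H.degree w ≤ 2) (hy : H.Adj w y) (hz : H.Adj w z) (hyz : y ≠ z) (hx : H.Adj w x) :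
    x = y ∨ x = z := by
  by_contra! hcon
  have hsub : ({x, y, z} : Finset V) ⊆ H.neighborFinset w := by
    intro a ha
    simp only [mem_insert, mem_singleton] at ha
    rcases ha with rfl | rfl | rfl <;> simpa
  have := Finset.card_le_card hsub
  rw [Finset.card_eq_three.2 ⟨x, y, z, hcon.1, hcon.2, hyz, rfl⟩,
    SimpleGraph.card_neighborFinset_eq_degree] at this
  omega

/-- Two of the paths in a colour class of maximum degree two form a cycle, which is closed in the
class and is avoided by the remaining paths. -/
theorem PathSystem.exists_closed_set [Fintype V] {φ : G.edgeSet → C} {k : ℕ} {u v : V}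
    (S : PathSystem φ k u v) (huv : u ≠ v) (hadj : ¬ G.Adj u v) {c : C}
    (hdeg : ∀ w, (colourGraph φ c).degree w ≤ 2) (hc : 2 ≤ S.count c) (hck : S.count c < k) :
    ∃ Z : Set V, u ∈ Z ∧ (∀ w x, (colourGraph φ c).Adj w x → w ∈ Z → x ∈ Z) ∧
      ∃ w, w ∉ Z ∧ G.Adj u w := by
  obtain ⟨i, hi, j, hj, hij⟩ := Finset.one_lt_card.1 hc
  obtain ⟨l, hl⟩ : ∃ l, S.colour l ≠ c := by
    by_contra! hcon
    have : S.count c = k := by simp [count, hcon]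
    omega
  have hi : S.colour i = c := by simpa using hi
  have hj : S.colour j = c := by simpa using hj
  have hli : l ≠ i := by rintro rfl; exact hl hi
  have hlj : l ≠ j := by rintro rfl; exact hl hj
  -- `Z` is the cycle formed by paths `i` and `j`; the vertex off it is the second vertex of a path
  -- of another colour.
  refine ⟨{w | w ∈ (S.path i).1.support ∨ w ∈ (S.path j).1.support}, by simp, ?_, S.snd l, ?_,
    colourGraph_le _ _ (S.adj_snd huv l)⟩
  · rintro w x hwx hw
    by_cases hwu : w = u
    · subst hwu
      have h1 := S.adj_snd huv i
      have h2 := S.adj_snd huv j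
      rw [hi] at h1
      rw [hj] at h2
      rcases eq_or_eq_of_degree_le_two (hdeg w) h1 h2
        (fun h => hij (S.snd_injective huv hadj h)) hwx with rfl | rfl
      · exact Or.inl (S.snd_mem i)
      · exact Or.inr (S.snd_mem j)
    by_cases hwv : w = v
    · subst hwv
      have h1 := (S.adj_penultimate huv i).symm
      have h2 := (S.adj_penultimate huv j).symm
      rw [hi] at h1
      rw [hj] at h2
      rcases eq_or_eq_of_degree_le_two (hdeg w) h1 h2
        (fun h => hij (S.penultimate_injective huv hadj h)) hwx with rfl | rfl
      · exact Or.inl (S.penultimate_mem i)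
      · exact Or.inr (S.penultimate_mem j)
    rcases hw with hw | hw
    · exact Or.inl (mem_support_of_adj_of_isPath (by rwa [hi]) (S.path i).2 hw hwu hwv
        (by rwa [hi]))
    · exact Or.inr (mem_support_of_adj_of_isPath (by rwa [hj]) (S.path j).2 hw hwu hwv
        (by rwa [hj]))
  · rintro (h | h)
    · exact hli (S.eq_of_snd_mem huv hadj h)
    · exact hlj (S.eq_of_snd_mem huv hadj h)

theorem sum_offDiag_add {X : Finset V} (d : V → ℕ) :
    ∑ q ∈ X.offDiag, (d q.1 + d q.2) = 2 * ((#X - 1) * ∑ x ∈ X, d x) := by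
  have h1 : ∑ q ∈ X ×ˢ X, (d q.1 + d q.2) = 2 * (#X * ∑ x ∈ X, d x) := by
    rw [Finset.sum_add_distrib, Finset.sum_product, Finset.sum_product]
    simp [Finset.sum_const, Finset.mul_sum, two_mul, Finset.sum_add_distrib]
  rw [← Finset.diag_union_offDiag, Finset.sum_union (Finset.disjoint_diag_offDiag X),
    Finset.sum_diag, Finset.sum_add_distrib] at h1
  rcases Nat.eq_zero_or_pos (#X) with h0 | h0
  · rw [Finset.card_eq_zero] at h0
    simp [h0]
  · obtain ⟨n, hn⟩ : ∃ n, #X = n + 1 := ⟨#X - 1, by omega⟩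
    dsimp only at h1
    rw [hn, add_mul] at h1
    rw [hn, Nat.add_sub_cancel]
    omega

/-- If a function `p` on pairs is bounded by `d` at both ends, and the bound is not sharp on the
pairs of a relation that separates each vertex from `x₀` or `x₁`, then the average of `p` drops by
one. -/
theorem sum_offDiag_le_of_separated {X : Finset V} {p : V → V → ℕ} {d : V → ℕ}
    (hp : ∀ x ∈ X, ∀ y ∈ X, x ≠ y → p x y ≤ d x ∧ p x y ≤ d y) (R : V → V → Prop)
    (hsymm : ∀ x y, R x y → R y x)
    (hR : ∀ x ∈ X, ∀ y ∈ X, x ≠ y → R x y → 2 * p x y < d x + d y)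
    {x₀ x₁ : V} (h₀ : x₀ ∈ X) (h₁ : x₁ ∈ X) (hne : x₀ ≠ x₁) (h₀₁ : R x₁ x₀)
    (hz : ∀ z ∈ X, R z x₀ ∨ R z x₁) :
    ∑ q ∈ X.offDiag, p q.1 q.2 ≤ (#X - 1) * (∑ x ∈ X, d x - 1) := by
  let g : V → V := fun z => if R z x₀ then x₀ else x₁
  have hg₁ : g x₁ = x₀ := if_pos h₀₁
  have hg : ∀ z ∈ X, R z (g z) ∧ g z ∈ X ∧ (g z = x₀ ∨ g z = x₁) := by
    intro z hzX
    simp only [g]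
    split_ifs with h
    · exact ⟨h, h₀, Or.inl rfl⟩
    · exact ⟨(hz z hzX).resolve_left h, h₁, Or.inr rfl⟩
  have hgne : ∀ z ∈ X, z ≠ x₀ → z ≠ g z := by
    intro z hzX hz0 h
    rcases (hg z hzX).2.2 with h' | h'
    · exact hz0 (h.trans h')
    · have : z = x₁ := h.trans h'
      rw [this, hg₁] at h
      exact hne h.symm
  -- Each `z ≠ x₀` is paired with its partner `g z`, in both orders. No pair occurs twice because `g
  -- x₁ = x₀` is excluded as a starting point.
  have hcount : 2 * (#X - 1) ≤ #(X.offDiag.filter fun q => R q.1 q.2) := by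
    have hdisj : Disjoint ((X.erase x₀).image fun z => (z, g z))
        ((X.erase x₀).image fun z => (g z, z)) := by
      rw [Finset.disjoint_left]
      rintro ⟨a, b⟩ hab hab'
      simp only [mem_image, mem_erase, Prod.mk.injEq] at hab hab'
      obtain ⟨z, ⟨hz0, hzX⟩, rfl, rfl⟩ := hab
      obtain ⟨w, ⟨hw0, hwX⟩, hwz, rfl⟩ := hab'
      rcases (hg _ hwX).2.2 with h | h
      · exact hz0 (hwz.symm.trans h)
      · have : z = x₁ := hwz.symm.trans h
        rw [this, hg₁] at hw0
        exact hw0 rfl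
    have hsub : ((X.erase x₀).image fun z => (z, g z)) ∪ ((X.erase x₀).image fun z => (g z, z)) ⊆
        X.offDiag.filter fun q => R q.1 q.2 := by
      intro q hq
      simp only [mem_union, mem_image, mem_erase] at hq
      rw [mem_filter, mem_offDiag]
      rcases hq with ⟨z, ⟨hz0, hzX⟩, rfl⟩ | ⟨z, ⟨hz0, hzX⟩, rfl⟩
      · exact ⟨⟨hzX, (hg z hzX).2.1, hgne z hzX hz0⟩, (hg z hzX).1⟩
      · exact ⟨⟨(hg z hzX).2.1, hzX, (hgne z hzX hz0).symm⟩, hsymm _ _ (hg z hzX).1⟩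
    have h := Finset.card_le_card hsub
    rw [Finset.card_union_of_disjoint hdisj,
      Finset.card_image_of_injective _ (fun a b h => (Prod.ext_iff.1 h).1),
      Finset.card_image_of_injective _ (fun a b h => (Prod.ext_iff.1 h).2),
      Finset.card_erase_of_mem h₀] at h
    omega
  -- Each related pair saves 1 in `2 * p ≤ d + d`, so the doubled sum drops by at least `2 * (#X -
  -- 1)`.
  have hsum : ∑ q ∈ X.offDiag, (2 * p q.1 q.2 + if R q.1 q.2 then 1 else 0) ≤
      ∑ q ∈ X.offDiag, (d q.1 + d q.2) := by
    refine Finset.sum_le_sum fun q hq => ?_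
    obtain ⟨hq1, hq2, hqne⟩ := Finset.mem_offDiag.1 hq
    have := hp _ hq1 _ hq2 hqne
    split_ifs with h
    · exact hR _ hq1 _ hq2 hqne h
    · omega
  rw [Finset.sum_add_distrib, ← Finset.mul_sum, sum_offDiag_add, ← Finset.card_filter] at hsum
  rw [Nat.mul_sub, mul_one]
  omega

end ColourClasses

/-! ### Efficient colours and their structure -/

section UpperBound

open scoped Classical

variable {V C : Type*} [Fintype V] {G : SimpleGraph V} {φ : G.edgeSet → C} {k : ℕ}

/-- The number of paths of colour `c` in a chosen path system between two non-adjacent vertices. -/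
noncomputable def pathCount (h : IsMonochromaticConnected k φ) (c : C) (u v : V) : ℕ :=
  if huv : u ≠ v then (h.nonempty_pathSystem huv).some.count c else 0

omit [Fintype V] in
theorem pathCount_of_ne (h : IsMonochromaticConnected k φ) {u v : V} (huv : u ≠ v) :
    ∃ S : PathSystem φ k u v, ∀ c, pathCount h c u v = S.count c :=
  ⟨(h.nonempty_pathSystem huv).some, fun c => by rw [pathCount, dif_pos huv]⟩

/-- The number of edges of colour `c`. -/
noncomputable def colourSize (φ : G.edgeSet → C) (c : C) : ℕ := #(colourGraph φ c).edgeFinset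

theorem colourSize_eq (φ : G.edgeSet → C) (c : C) : colourSize φ c = #{e | φ e = c} := by
  refine (Finset.card_bij (fun e _ => e.1) ?_ ?_ ?_).symm
  · intro e he
    rw [SimpleGraph.mem_edgeFinset, mem_edgeSet_colourGraph]
    exact ⟨e.2, by simpa using he⟩
  · intro a _ b _ hab
    exact Subtype.ext hab
  · intro e he
    rw [SimpleGraph.mem_edgeFinset, mem_edgeSet_colourGraph] at he
    obtain ⟨h, hc⟩ := he
    exact ⟨⟨e, h⟩, by simpa using hc, rfl⟩

theorem sum_colourSize [Fintype C] (φ : G.edgeSet → C) :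
    ∑ c, colourSize φ c = #G.edgeFinset := by
  simp_rw [colourSize_eq]
  rw [← Finset.card_eq_sum_card_fiberwise (f := φ) (s := univ) (t := univ) (by simp)]
  rw [Finset.card_univ, SimpleGraph.edgeFinset_card]

theorem one_le_colourSize (hφ : Function.Surjective φ) (c : C) : 1 ≤ colourSize φ c := by
  obtain ⟨e, he⟩ := hφ c
  rw [colourSize_eq]
  exact Finset.card_pos.2 ⟨e, by simpa using he⟩

variable {X Y : Finset V}

omit [Fintype V] in
theorem isBipartiteWith_colourGraph (hG : G.IsBipartiteWith X Y) (c : C) :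
    (colourGraph φ c).IsBipartiteWith X Y :=
  ⟨hG.disjoint, fun _ _ h => hG.mem_of_adj h.1⟩

theorem sum_degree_colourGraph (hG : G.IsBipartiteWith X Y) (c : C) :
    ∑ x ∈ X, (colourGraph φ c).degree x = colourSize φ c :=
  SimpleGraph.isBipartiteWith_sum_degrees_eq_card_edges (isBipartiteWith_colourGraph hG c)

omit [Fintype V] in
theorem not_adj_of_mem (hG : G.IsBipartiteWith X Y) {x y : V} (hx : x ∈ X) (hy : y ∈ X) :
    ¬ G.Adj x y := fun h =>
  Set.disjoint_left.1 hG.disjoint (Finset.mem_coe.2 hy) (hG.mem_of_mem_adj hx h)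

theorem pathCount_le (h : IsMonochromaticConnected k φ) (hG : G.IsBipartiteWith X Y) (c : C)
    {x y : V} (hx : x ∈ X) (hy : y ∈ X) (hxy : x ≠ y) :
    pathCount h c x y ≤ (colourGraph φ c).degree x ∧
      pathCount h c x y ≤ (colourGraph φ c).degree y := by
  obtain ⟨S, hS⟩ := pathCount_of_ne h hxy
  rw [hS]
  exact ⟨S.count_le_degree_left hxy (not_adj_of_mem hG hx hy) c,
    S.count_le_degree_right hxy (not_adj_of_mem hG hx hy) c⟩

/-- A colour is efficient on `X` if it carries more paths between the vertices of `X` than its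
number of edges minus one accounts for. -/
def IsEfficient (h : IsMonochromaticConnected k φ) (X : Finset V) (c : C) : Prop :=
  (#X - 1) * (colourSize φ c - 1) < ∑ q ∈ X.offDiag, pathCount h c q.1 q.2

/-- The count for a pair is at most the average of the two degrees, and the degrees on `X` sum to
the number of edges. -/
theorem sum_pathCount_le (h : IsMonochromaticConnected k φ) (hG : G.IsBipartiteWith X Y) (c : C) :
    ∑ q ∈ X.offDiag, pathCount h c q.1 q.2 ≤ (#X - 1) * colourSize φ c := by
  have h1 : ∑ q ∈ X.offDiag, 2 * pathCount h c q.1 q.2 ≤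
      ∑ q ∈ X.offDiag, ((colourGraph φ c).degree q.1 + (colourGraph φ c).degree q.2) := by
    refine Finset.sum_le_sum fun q hq => ?_
    obtain ⟨hq1, hq2, hqne⟩ := Finset.mem_offDiag.1 hq
    have := pathCount_le h hG c hq1 hq2 hqne
    omega
  have h2 := h1.trans_eq (sum_offDiag_add fun v => (colourGraph φ c).degree v)
  rw [← Finset.mul_sum, sum_degree_colourGraph hG] at h2
  omega

/-- Double counting of paths over ordered pairs: after division by `#X - 1`, a colour accounts for
at most its waste, plus 1 if it is efficient. -/
theorem le_waste_add_card_efficient [Fintype C] (h : IsMonochromaticConnected k φ)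
    (hφ : Function.Surjective φ) (hG : G.IsBipartiteWith X Y) (hX : 2 ≤ #X) :
    k * #X ≤ ∑ c, (colourSize φ c - 1) + #{c | IsEfficient h X c} := by
  obtain ⟨n, hn⟩ : ∃ n, #X = n + 2 := ⟨#X - 2, by omega⟩
  have h1 : ∑ c, ∑ q ∈ X.offDiag, pathCount h c q.1 q.2 = (#X - 1) * (k * #X) := by
    rw [Finset.sum_comm]
    have : ∀ q ∈ X.offDiag, ∑ c, pathCount h c q.1 q.2 = k := by
      intro q hq
      obtain ⟨S, hS⟩ := pathCount_of_ne h (Finset.mem_offDiag.1 hq).2.2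
      simp_rw [hS, S.sum_count]
    rw [Finset.sum_congr rfl this, Finset.sum_const, Finset.offDiag_card, smul_eq_mul]
    rw [hn]
    have : (n + 2) * (n + 2) - (n + 2) = (n + 1) * (n + 2) := by
      rw [Nat.sub_eq_iff_eq_add (by nlinarith)]
      ring
    rw [this, show n + 2 - 1 = n + 1 by omega]
    ring
  have h2 : ∑ c, ∑ q ∈ X.offDiag, pathCount h c q.1 q.2 ≤
      ∑ c, (#X - 1) * ((colourSize φ c - 1) + if IsEfficient h X c then 1 else 0) := by
    refine Finset.sum_le_sum fun c _ => ?_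
    split_ifs with hc
    · rw [Nat.sub_add_cancel (one_le_colourSize hφ c)]
      exact sum_pathCount_le h hG c
    · exact not_lt.1 hc
  rw [h1, ← Finset.mul_sum, Finset.sum_add_distrib, ← Finset.card_filter] at h2
  exact Nat.le_of_mul_le_mul_left h2 (by omega)

/-- A colour class that does not connect `X`, as witnessed by the invariant `f`, is inefficient. -/
theorem not_isEfficient_of_invariant (h : IsMonochromaticConnected k φ)
    (hG : G.IsBipartiteWith X Y) {c : C} (hd : ∀ x ∈ X, 1 ≤ (colourGraph φ c).degree x)
    {T : Type*} (f : V → T) (hf : ∀ u v, (colourGraph φ c).Reachable u v → f u = f v) {x₀ x₁ : V}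
    (h₀ : x₀ ∈ X) (h₁ : x₁ ∈ X) (hne : f x₀ ≠ f x₁) : ¬ IsEfficient h X c := by
  rw [IsEfficient, not_lt, ← sum_degree_colourGraph hG]
  refine sum_offDiag_le_of_separated (fun x hx y hy => pathCount_le h hG c hx hy)
    (fun x y => f x ≠ f y) (fun _ _ => Ne.symm) ?_ h₀ h₁ (fun h => hne (h ▸ rfl)) hne.symm ?_
  · intro x hx y hy hxy hfxy
    obtain ⟨S, hS⟩ := pathCount_of_ne h hxy
    have : S.count c = 0 := by
      by_contra hc
      exact hfxy (hf _ _ (S.reachable_of_count_pos (Nat.pos_of_ne_zero hc)))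
    have := hd x hx
    rw [hS]
    omega
  · intro z _
    by_contra! hcon
    exact hne (hcon.1.symm.trans hcon.2)

omit [Fintype V] in
theorem reachable_invariant {H : SimpleGraph V} {T : Type*} {f : V → T}
    (hf : ∀ u v, H.Adj u v → f u = f v) {u v : V} (h : H.Reachable u v) : f u = f v := by
  obtain ⟨p⟩ := h
  induction p with
  | nil => rfl
  | cons ha _ ih => exact (hf _ _ ha).trans ih

/-- For unequal degrees the minimum is strictly below the average, and every vertex differs in
degree from `x` or from `y`. -/
theorem degree_eq_of_isEfficient (h : IsMonochromaticConnected k φ) (hG : G.IsBipartiteWith X Y)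
    {c : C} (hc : IsEfficient h X c) {x y : V} (hx : x ∈ X) (hy : y ∈ X) :
    (colourGraph φ c).degree x = (colourGraph φ c).degree y := by
  by_contra hne
  refine absurd hc ?_
  rw [IsEfficient, not_lt, ← sum_degree_colourGraph hG]
  refine sum_offDiag_le_of_separated (fun x hx y hy => pathCount_le h hG c hx hy)
    (fun x y => (colourGraph φ c).degree x ≠ (colourGraph φ c).degree y) (fun _ _ => Ne.symm) ?_
    hx hy (fun h => hne (h ▸ rfl)) (Ne.symm hne) ?_
  · intro x hx y hy hxy hfxy
    have := pathCount_le h hG c hx hy hxy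
    omega
  · intro z _
    omega

/-- With all degrees 1 on `X` the class is a union of stars centred in `Y`, and `f` names the
centre. Several stars would leave `X` disconnected in the class, so there would be just one. -/
theorem degree_ne_one_of_isEfficient (h : IsMonochromaticConnected k φ) (hk : 1 ≤ k)
    (hG : G.IsBipartiteWith X Y) (hY : 2 ≤ #Y) {c : C} (hc : IsEfficient h X c) (hX : X.Nonempty) :
    ¬ ∀ x ∈ X, (colourGraph φ c).degree x = 1 := by
  intro hd
  have hex : ∀ v, ∃ w, (v ∈ X → (colourGraph φ c).Adj v w ∧
      ∀ w', (colourGraph φ c).Adj v w' → w' = w) ∧ (v ∉ X → w = v) := by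
    intro v
    by_cases hv : v ∈ X
    · obtain ⟨w, hw, huniq⟩ := SimpleGraph.degree_eq_one_iff_existsUnique_adj.1 (hd v hv)
      exact ⟨w, fun _ => ⟨hw, huniq⟩, fun h => absurd hv h⟩
    · exact ⟨v, fun h => absurd h hv, fun _ => rfl⟩
  choose f hfX hfY using hex
  have hYX : ∀ {y}, y ∈ Y → y ∉ X := fun hy hx =>
    Set.disjoint_left.1 hG.disjoint (Finset.mem_coe.2 hx) (Finset.mem_coe.2 hy)
  have hf : ∀ u v, (colourGraph φ c).Reachable u v → f u = f v := by
    intro u v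
    apply reachable_invariant
    intro u v huv
    rcases hG.mem_of_adj huv.1 with ⟨hu, hv⟩ | ⟨hu, hv⟩
    · rw [hfY v (hYX (Finset.mem_coe.1 hv))]
      exact ((hfX u hu).2 v huv).symm
    · rw [hfY u (hYX (Finset.mem_coe.1 hu))]
      exact (hfX v hv).2 u huv.symm
  obtain ⟨x₀, hx₀⟩ := hX
  by_cases hstar : ∀ x ∈ X, f x = f x₀
  · have hy₀ : f x₀ ∈ Y := hG.mem_of_mem_adj hx₀ (hfX x₀ hx₀).1.1
    obtain ⟨y₁, hy₁, hne⟩ := Finset.exists_mem_ne (by omega : 1 < #Y) (f x₀)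
    -- All edges at the centre of the single star have colour `c`, so a monochromatic path to
    -- another vertex of `Y` cannot leave the star.
    obtain ⟨S⟩ := h.nonempty_pathSystem hne.symm
    have hadj := S.adj_snd hne.symm ⟨0, hk⟩
    have hx : S.snd ⟨0, hk⟩ ∈ X := hG.symm.mem_of_mem_adj hy₀ hadj.1
    have hadj' := (hfX _ hx).1
    rw [hstar _ hx] at hadj'
    have hcol := colour_unique hadj'.symm hadj
    have hr : (colourGraph φ c).Reachable (f x₀) y₁ := by
      rw [hcol]
      exact ⟨(S.path ⟨0, hk⟩).1⟩
    have := hf _ _ hr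
    rw [hfY _ (hYX hy₁), hfY _ (hYX hy₀)] at this
    exact hne this.symm
  · push Not at hstar
    obtain ⟨x₁, hx₁, hne⟩ := hstar
    exact not_isEfficient_of_invariant h hG (fun x hx => (hd x hx).ge) f hf hx₀ hx₁ hne.symm hc

theorem exists_degree_of_isEfficient (h : IsMonochromaticConnected k φ) (hk : 1 ≤ k)
    (hφ : Function.Surjective φ) (hG : G.IsBipartiteWith X Y) (hX : X.Nonempty) (hY : 2 ≤ #Y)
    {c : C} (hc : IsEfficient h X c) :
    ∃ d, 2 ≤ d ∧ (∀ x ∈ X, (colourGraph φ c).degree x = d) ∧ colourSize φ c = #X * d := by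
  obtain ⟨x₀, hx₀⟩ := id hX
  have hd : ∀ x ∈ X, (colourGraph φ c).degree x = (colourGraph φ c).degree x₀ :=
    fun x hx => degree_eq_of_isEfficient h hG hc hx hx₀
  have hsize : colourSize φ c = #X * (colourGraph φ c).degree x₀ := by
    rw [← sum_degree_colourGraph hG, Finset.sum_congr rfl hd, Finset.sum_const, smul_eq_mul]
  refine ⟨_, ?_, hd, hsize⟩
  have h1 : (colourGraph φ c).degree x₀ ≠ 1 := fun h1 =>
    degree_ne_one_of_isEfficient h hk hG hY hc hX fun x hx => (hd x hx).trans h1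
  have h0 : (colourGraph φ c).degree x₀ ≠ 0 := by
    intro h0
    have := one_le_colourSize hφ c
    rw [hsize, h0] at this
    omega
  omega

/-- If every pair carries at most one path, the total is too small. Otherwise two paths form a
cycle, a component of the class; as `k ≥ 3`, a path of another colour finds a vertex of `Y` off this
cycle, whose neighbours in the class are vertices of `X` not connected to it. -/
theorem not_isEfficient_of_two_regular (h : IsMonochromaticConnected k φ) (hk : 3 ≤ k)
    (hG : G.IsBipartiteWith X Y) {c : C} (hdX : ∀ x ∈ X, (colourGraph φ c).degree x = 2)
    (hdY : ∀ y ∈ Y, (colourGraph φ c).degree y = 2) : ¬ IsEfficient h X c := by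
  have hdeg : ∀ w, (colourGraph φ c).degree w ≤ 2 := by
    intro w
    by_contra! hw
    obtain ⟨x, hx⟩ := (SimpleGraph.degree_pos_iff_exists_adj (G := colourGraph φ c) (v := w)).1 (by omega)
    rcases hG.mem_of_adj hx.1 with ⟨hw', -⟩ | ⟨hw', -⟩
    · exact hw.ne' (hdX w hw')
    · exact hw.ne' (hdY w hw')
  by_cases hone : ∀ x ∈ X, ∀ y ∈ X, x ≠ y → pathCount h c x y ≤ 1
  · have hsum : ∑ q ∈ X.offDiag, pathCount h c q.1 q.2 ≤ ∑ q ∈ X.offDiag, 1 := by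
      refine Finset.sum_le_sum fun q hq => ?_
      obtain ⟨hq1, hq2, hqne⟩ := Finset.mem_offDiag.1 hq
      exact hone _ hq1 _ hq2 hqne
    have hsize : colourSize φ c = #X * 2 := by
      rw [← sum_degree_colourGraph hG, Finset.sum_congr rfl hdX, Finset.sum_const, smul_eq_mul]
    rw [IsEfficient, not_lt, hsize]
    refine hsum.trans ?_
    rw [Finset.sum_const, smul_eq_mul, mul_one, Finset.offDiag_card]
    rcases Nat.eq_zero_or_pos (#X) with h0 | h0
    · simp [h0]
    · rw [← Nat.sub_one_mul]
      exact Nat.mul_le_mul_left _ (by omega)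
  · push Not at hone
    obtain ⟨x, hx, y, hy, hxy, h2⟩ := hone
    obtain ⟨S, hS⟩ := pathCount_of_ne h hxy
    rw [hS] at h2
    have hadj := not_adj_of_mem hG hx hy
    have hlt : S.count c < k := ((S.count_le_degree_left hxy hadj c).trans (hdeg x)).trans_lt hk
    obtain ⟨Z, hxZ, hclosed, w, hwZ, hxw⟩ := S.exists_closed_set hxy hadj hdeg h2 hlt
    have hwY : w ∈ Y := hG.mem_of_mem_adj hx hxw
    obtain ⟨x₁, hx₁⟩ := (SimpleGraph.degree_pos_iff_exists_adj (G := colourGraph φ c) (v := w)).1 (by rw [hdY w hwY]; omega)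
    have hx₁X : x₁ ∈ X := hG.symm.mem_of_mem_adj hwY hx₁.1
    have hx₁Z : x₁ ∉ Z := fun h => hwZ (hclosed _ _ hx₁.symm h)
    refine not_isEfficient_of_invariant h hG (fun x hx => by rw [hdX x hx]; omega) (· ∈ Z) ?_ hx hx₁X ?_
    · intro u v
      apply reachable_invariant
      intro u v huv
      exact propext ⟨hclosed _ _ huv, hclosed _ _ huv.symm⟩
    · simp [hxZ, hx₁Z]

end UpperBound

/-! ### Lower bounds on the number of wasted edges -/

section Counting

open scoped Classical

variable {V : Type*} [Fintype V] {G : SimpleGraph V} {k r : ℕ} {φ : G.edgeSet → Fin r}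
  {X Y : Finset V}

theorem waste_add_colours (hφ : Function.Surjective φ) :
    ∑ c, (colourSize φ c - 1) + r = #G.edgeFinset := by
  have h1 : ∑ c, ((colourSize φ c - 1) + 1) = #G.edgeFinset := by
    rw [← sum_colourSize φ]
    exact Finset.sum_congr rfl fun c _ => Nat.sub_add_cancel (one_le_colourSize hφ c)
  simpa [Finset.sum_add_distrib] using h1

theorem card_mul_le_waste (S : Finset (Fin r)) {n : ℕ} (hS : ∀ c ∈ S, n ≤ colourSize φ c) :
    #S * (n - 1) ≤ ∑ c, (colourSize φ c - 1) := by
  rw [← smul_eq_mul]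
  exact (Finset.card_nsmul_le_sum S _ _ fun c hc => Nat.sub_le_sub_right (hS c hc) 1).trans
    (Finset.sum_le_sum_of_subset (Finset.subset_univ S))

theorem two_mul_card_le_of_isEfficient (h : IsMonochromaticConnected k φ) (hk : 1 ≤ k)
    (hφ : Function.Surjective φ) (hG : G.IsBipartiteWith X Y) (hX : 2 ≤ #X) (hY : 2 ≤ #Y)
    {c : Fin r} (hc : IsEfficient h X c) : 2 * #X ≤ colourSize φ c := by
  obtain ⟨d, hd, -, hsize⟩ := exists_degree_of_isEfficient h hk hφ hG
    (Finset.card_pos.1 (by omega)) hY hc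
  rw [hsize, mul_comm]
  exact Nat.mul_le_mul_left _ hd

/-- The number `m` of efficient colours bounds the number of wasted edges in two ways. -/
theorem exists_waste_bounds (h : IsMonochromaticConnected k φ) (hk : 1 ≤ k)
    (hφ : Function.Surjective φ) (hG : G.IsBipartiteWith X Y) (hX : 2 ≤ #X) (hY : 2 ≤ #Y) :
    ∃ m, k * #X ≤ ∑ c, (colourSize φ c - 1) + m ∧
      m * (2 * #X - 1) ≤ ∑ c, (colourSize φ c - 1) := by
  refine ⟨_, le_waste_add_card_efficient h hφ hG hX, card_mul_le_waste _ fun c hc => ?_⟩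
  exact two_mul_card_le_of_isEfficient h hk hφ hG hX hY (by simpa using hc)

/-- If one class has at most one efficient colour, the path count for it suffices. Otherwise several
expensive colours force enough waste. -/
theorem le_waste_add_one_of_balanced (h : IsMonochromaticConnected k φ) (hk3 : 3 ≤ k) (hk5 : k ≤ 5)
    (hφ : Function.Surjective φ) (hG : G.IsBipartiteWith X Y) (hX : 2 ≤ #X) (hXY : #Y = #X) :
    k * #X ≤ ∑ c, (colourSize φ c - 1) + 1 := by
  have hkX : k * #X ≤ 5 * #X := Nat.mul_le_mul_right _ hk5
  have hX1 := le_waste_add_card_efficient h hφ hG hX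
  have hY1 := le_waste_add_card_efficient h hφ hG.symm (by omega)
  rw [hXY] at hY1
  set EX : Finset (Fin r) := {c | IsEfficient h X c}
  set EY : Finset (Fin r) := {c | IsEfficient h Y c}
  have hU := card_mul_le_waste (φ := φ) (EX ∪ EY) (n := 2 * #X) (by
    intro c hc
    rcases Finset.mem_union.1 hc with hc | hc
    · exact two_mul_card_le_of_isEfficient h (by omega) hφ hG hX (by omega) (by simpa [EX] using hc)
    · rw [← hXY]
      exact two_mul_card_le_of_isEfficient h (by omega) hφ hG.symm (by omega) hX
        (by simpa [EY] using hc))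
  -- Three such colours waste `6 * #X - 3 ≥ 5 * #X - 1` edges.
  by_cases h3 : 3 ≤ #(EX ∪ EY)
  · have := (Nat.mul_le_mul_right (2 * #X - 1) h3).trans hU
    omega
  by_cases hEX : #EX ≤ 1
  · omega
  by_cases hEY : #EY ≤ 1
  · omega
  -- At most two colours in the union and at least two in each set: the sets coincide. Both colours
  -- are then regular of equal degree at least 3 on both sides.
  have h1 : EX = EX ∪ EY := Finset.eq_of_subset_of_card_le Finset.subset_union_left (by omega)
  have h2 : EY = EX ∪ EY := Finset.eq_of_subset_of_card_le Finset.subset_union_right (by omega)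
  have hW := card_mul_le_waste (φ := φ) EX (n := 3 * #X) (by
    intro c hc
    have hcX : IsEfficient h X c := by simpa [EX] using hc
    have hcY : IsEfficient h Y c := by
      rw [h1, ← h2] at hc
      simpa [EY] using hc
    obtain ⟨d, hd, hdX, hsize⟩ := exists_degree_of_isEfficient h (by omega) hφ hG
      (Finset.card_pos.1 (by omega)) (by omega) hcX
    obtain ⟨d', -, hdY, hsize'⟩ := exists_degree_of_isEfficient h (by omega) hφ hG.symm
      (Finset.card_pos.1 (by omega)) hX hcY
    obtain rfl : d = d' := by
      rw [hsize, hXY] at hsize'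
      exact Nat.eq_of_mul_eq_mul_left (by omega) hsize'
    have hd2 : d ≠ 2 := by
      rintro rfl
      exact not_isEfficient_of_two_regular h hk3 hG hdX hdY hcX
    rw [hsize, mul_comm]
    exact Nat.mul_le_mul_left _ (by omega))
  have := (Nat.mul_le_mul_right (3 * #X - 1) (by omega : 2 ≤ #EX)).trans hW
  omega

-- The `k` second vertices exhaust `Y`, so the last but one vertex of a path is also some path's
-- second vertex, by disjointness its own. Hence every path has length two.
omit [Fintype V] in
theorem exists_colour_of_card_eq (h : IsMonochromaticConnected k φ) (hG : G.IsBipartiteWith X Y)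
    (hY : #Y = k) {x x' y : V} (hx : x ∈ X) (hx' : x' ∈ X) (hxx' : x ≠ x') (hy : y ∈ Y) :
    ∃ c, (colourGraph φ c).Adj x y ∧ (colourGraph φ c).Adj x' y := by
  obtain ⟨S⟩ := h.nonempty_pathSystem hxx'
  have hadj := not_adj_of_mem hG hx hx'
  have hsurj : ∀ z ∈ Y, ∃ i, S.snd i = z := by
    have himg : univ.image S.snd = Y := by
      apply Finset.eq_of_subset_of_card_le
      · intro z hz
        obtain ⟨i, -, rfl⟩ := Finset.mem_image.1 hz
        exact hG.mem_of_mem_adj hx (S.adj_snd hxx' i).1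
      · rw [Finset.card_image_of_injective _ (S.snd_injective hxx' hadj), Finset.card_univ,
          Fintype.card_fin, hY]
    intro z hz
    rw [← himg] at hz
    simpa using hz
  obtain ⟨i, rfl⟩ := hsurj y hy
  obtain ⟨j, hj⟩ := hsurj (S.penultimate i)
    (hG.mem_of_mem_adj hx' (S.adj_penultimate hxx' i).1.symm)
  obtain rfl : j = i := S.eq_of_snd_mem hxx' hadj (hj ▸ S.penultimate_mem i)
  refine ⟨_, S.adj_snd hxx' j, ?_⟩
  have := (S.adj_penultimate hxx' j).symm
  rwa [← hj] at this

-- All edges at a vertex of `Y` have the same colour, and a monochromatic path between two vertices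
-- of `Y` makes their colours agree.
omit [Fintype V] in
theorem colours_le_one_of_card_eq (h : IsMonochromaticConnected k φ) (hk : 1 ≤ k)
    (hφ : Function.Surjective φ) (hG : G.IsBipartiteWith X Y) (hY : #Y = k) : r ≤ 1 := by
  have hsame : ∀ {x x' y c c'}, y ∈ Y → (colourGraph φ c).Adj x y → (colourGraph φ c').Adj x' y →
      c = c' := by
    intro x x' y c c' hy hc hc'
    by_cases hxx' : x = x'
    · subst hxx'
      exact colour_unique hc hc'
    · obtain ⟨d, hd, hd'⟩ := exists_colour_of_card_eq h hG hY
        (hG.symm.mem_of_mem_adj hy hc.1.symm) (hG.symm.mem_of_mem_adj hy hc'.1.symm) hxx' hy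
      exact (colour_unique hc hd).trans (colour_unique hd' hc')
  have hall : ∀ {x x' y y' c c'}, y ∈ Y → y' ∈ Y → (colourGraph φ c).Adj x y →
      (colourGraph φ c').Adj x' y' → c = c' := by
    intro x x' y y' c c' hy hy' hc hc'
    by_cases hyy' : y = y'
    · subst hyy'
      exact hsame hy hc hc'
    · obtain ⟨S⟩ := h.nonempty_pathSystem hyy'
      exact (hsame hy hc (S.adj_snd hyy' ⟨0, hk⟩).symm).trans
        (hsame hy' (S.adj_penultimate hyy' ⟨0, hk⟩) hc')
  have hedge : ∀ c, ∃ x y, y ∈ Y ∧ (colourGraph φ c).Adj x y := by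
    intro c
    obtain ⟨⟨e, he⟩, hc⟩ := hφ c
    induction e using Sym2.ind with
    | _ x y =>
      have hxy : (colourGraph φ c).Adj x y := ⟨he, hc⟩
      rcases hG.mem_of_adj hxy.1 with ⟨-, hy⟩ | ⟨-, hx⟩
      · rcases hG.mem_of_adj hxy.1 with ⟨-, hy⟩ | ⟨hx, -⟩
        · exact ⟨x, y, hy, hxy⟩
        · exact ⟨y, x, hx, hxy.symm⟩
      · rcases hG.mem_of_adj hxy.1 with ⟨-, hy⟩ | ⟨hx, -⟩
        · exact ⟨x, y, hy, hxy⟩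
        · exact ⟨y, x, hx, hxy.symm⟩
  by_contra! hr
  obtain ⟨x, y, hy, hxy⟩ := hedge ⟨0, by omega⟩
  obtain ⟨x', y', hy', hxy'⟩ := hedge ⟨1, hr⟩
  simpa using hall hy hy' hxy hxy'

end Counting

/-! ### Specialisation to complete bipartite graphs -/

section CompleteBipartite

theorem isBipartiteWith_completeBipartiteGraph (A B : Type*) [Fintype A] [Fintype B] :
    (completeBipartiteGraph A B).IsBipartiteWith
      ((univ : Finset B).map ⟨Sum.inr, Sum.inr_injective⟩ : Finset (A ⊕ B))
      ((univ : Finset A).map ⟨Sum.inl, Sum.inl_injective⟩ : Finset (A ⊕ B)) := by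
  constructor
  · rw [Set.disjoint_left]
    rintro (a | b) <;> simp
  · rintro (a | b) (a' | b') <;> simp

variable {s t k : ℕ}

theorem mc_mem_colourNumbers (hk : 2 ≤ k) (hks : k ≤ s) (hst : s ≤ t) :
    mc k (completeBipartiteGraph (Fin s) (Fin t)) ∈
        colourNumbers (completeBipartiteGraph (Fin s) (Fin t)) k ∧
      s * t + 1 ≤ mc k (completeBipartiteGraph (Fin s) (Fin t)) + k * t := by
  obtain ⟨r, hr, hle⟩ := exists_colourNumber_completeBipartiteGraph hk hks hst
  have hg := isGreatest_mc k (completeBipartiteGraph (Fin s) (Fin t)) ⟨r, hr⟩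
  have := hg.2 hr
  exact ⟨hg.1, by omega⟩

-- Here `w` is the waste of an optimal colouring and `m` the number of colours efficient on the
-- class of size `t`.
open scoped Classical in
theorem mc_completeBipartiteGraph_bounds (hk : 2 ≤ k) (hks : k ≤ s) (hst : s ≤ t) :
    ∃ w m, w + mc k (completeBipartiteGraph (Fin s) (Fin t)) = s * t ∧ k * t ≤ w + m ∧
      m * (2 * t - 1) ≤ w ∧ (s = t → 3 ≤ k → k ≤ 5 → k * t ≤ w + 1) ∧
      (s = k → mc k (completeBipartiteGraph (Fin s) (Fin t)) ≤ 1) := by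
  obtain ⟨φ, hφ, h⟩ := (MonoConn.mc_mem_colourNumbers hk hks hst).1
  have hG := isBipartiteWith_completeBipartiteGraph (Fin s) (Fin t)
  set X : Finset (Fin s ⊕ Fin t) := univ.map ⟨Sum.inr, Sum.inr_injective⟩ with hXdef
  set Y : Finset (Fin s ⊕ Fin t) := univ.map ⟨Sum.inl, Sum.inl_injective⟩ with hYdef
  have hX : #X = t := by simp [hXdef]
  have hY : #Y = s := by simp [hYdef]
  obtain ⟨m, h1, h2⟩ := exists_waste_bounds h (by omega) hφ hG (by omega) (by omega)
  have hw := waste_add_colours hφ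
  rw [card_edgeFinset_completeBipartiteGraph_fin] at hw
  rw [hX] at h1 h2
  refine ⟨_, m, hw, h1, h2, ?_, ?_⟩
  · intro hst' h3 h5
    have := le_waste_add_one_of_balanced h h3 h5 hφ hG (by omega) (by omega)
    rwa [hX] at this
  · rintro hsk
    exact colours_le_one_of_card_eq h (by omega) hφ hG (hY.trans hsk)

end CompleteBipartite

end MonoConn

/-! ### The main theorem: arithmetic with `w` and `m` -/

theorem mainTheorem6 :
    (∀ s t k : ℕ, 2 ≤ k → k ≤ s → s ≤ t →
      ((s : ℤ) * t - k * t + 1 ≤ MonoConn.mc k (completeBipartiteGraph (Fin s) (Fin t)) ∧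
        (MonoConn.mc k (completeBipartiteGraph (Fin s) (Fin t)) : ℤ) ≤
          s * t - ⌈(k : ℚ) * t / 2⌉ + 1) ∧
      (s = k ∨ k = 2 ∨ k = 3 →
        (MonoConn.mc k (completeBipartiteGraph (Fin s) (Fin t)) : ℤ) = s * t - k * t + 1)) ∧
    (∀ t k : ℕ, 2 ≤ k → k ≤ t →
      ((t : ℤ) ^ 2 - k * t + 1 ≤ MonoConn.mc k (completeBipartiteGraph (Fin t) (Fin t)) ∧
        (MonoConn.mc k (completeBipartiteGraph (Fin t) (Fin t)) : ℤ) ≤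
          t ^ 2 - ⌈((k : ℚ) - 1 / 2) * t⌉ + 1) ∧
      (k = 2 ∨ k = 3 ∨ k = 4 ∨ k = 5 →
        (MonoConn.mc k (completeBipartiteGraph (Fin t) (Fin t)) : ℤ) = t ^ 2 - k * t + 1)) := by
  -- Two efficient colours already waste `4t - 2 ≥ 3t - 1` edges.
  have hsmall : ∀ {t k w m : ℕ}, k ≤ t → 2 ≤ k → k ≤ 3 → k * t ≤ w + m → m * (2 * t - 1) ≤ w →
      k * t ≤ w + 1 := by
    intro t k w m hkt hk hk3 h1 h2
    by_cases hm : m ≤ 1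
    · omega
    · have := (Nat.mul_le_mul_right (2 * t - 1) (by omega : 2 ≤ m)).trans h2
      have := Nat.mul_le_mul_right t hk3
      omega
  constructor
  · intro s t k hk hks hst
    have hlow := (MonoConn.mc_mem_colourNumbers hk hks hst).2
    obtain ⟨w, m, hw, h1, h2, -, h4⟩ := MonoConn.mc_completeBipartiteGraph_bounds hk hks hst
    set M := MonoConn.mc k (completeBipartiteGraph (Fin s) (Fin t))
    have hlow' : (s : ℤ) * t - k * t + 1 ≤ M := by
      have : (s : ℤ) * t + 1 ≤ M + k * t := by exact_mod_cast hlow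
      linarith
    have hw' : (w : ℤ) + M = s * t := by exact_mod_cast hw
    refine ⟨⟨hlow', ?_⟩, fun hcase => le_antisymm ?_ hlow'⟩
    · have hkt : k * t ≤ 2 * w := by
        have : m * 1 ≤ m * (2 * t - 1) := Nat.mul_le_mul_left _ (by omega)
        omega
      have hceil : ⌈(k : ℚ) * t / 2⌉ ≤ (w : ℤ) := by
        rw [Int.ceil_le]
        have : (k : ℚ) * t ≤ 2 * w := by exact_mod_cast hkt
        push_cast
        linarith
      linarith
    · rcases hcase with rfl | hcase
      · have : (M : ℤ) ≤ 1 := by exact_mod_cast h4 rfl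
        linarith
      · have := hsmall (hks.trans hst) hk (by omega) h1 h2
        have : (k : ℤ) * t ≤ w + 1 := by exact_mod_cast this
        linarith
  · intro t k hk hkt
    have hlow := (MonoConn.mc_mem_colourNumbers hk hkt le_rfl).2
    obtain ⟨w, m, hw, h1, h2, h3, -⟩ := MonoConn.mc_completeBipartiteGraph_bounds hk hkt (le_refl t)
    set M := MonoConn.mc k (completeBipartiteGraph (Fin t) (Fin t))
    have hlow' : (t : ℤ) ^ 2 - k * t + 1 ≤ M := by
      have : (t : ℤ) * t + 1 ≤ M + k * t := by exact_mod_cast hlow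
      linarith
    have hw' : (w : ℤ) + M = t * t := by exact_mod_cast hw
    refine ⟨⟨hlow', ?_⟩, fun hcase => le_antisymm ?_ hlow'⟩
    · have hbound : 2 * (k * t) ≤ 2 * w + 2 + t := by
        by_cases hm : 2 * m ≤ t + 2
        · omega
        · have h5 : (t + 3) * (2 * t - 1) ≤ 2 * w := by
            have := Nat.mul_le_mul_right (2 * t - 1) (by omega : t + 3 ≤ 2 * m)
            rw [mul_assoc] at this
            omega
          have h6 : k * t ≤ t * t := Nat.mul_le_mul_right _ hkt
          obtain ⟨n, rfl⟩ : ∃ n, t = n + 1 := ⟨t - 1, by omega⟩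
          rw [show 2 * (n + 1) - 1 = 2 * n + 1 by omega] at h5
          nlinarith
      have hceil : ⌈((k : ℚ) - 1 / 2) * t⌉ ≤ (w : ℤ) + 1 := by
        rw [Int.ceil_le]
        have : 2 * ((k : ℚ) * t) ≤ 2 * w + 2 + t := by exact_mod_cast hbound
        push_cast
        linarith
      linarith
    · have : k * t ≤ w + 1 := by
        by_cases hk3 : k ≤ 3
        · exact hsmall hkt hk hk3 h1 h2
        · exact h3 rfl (by omega) (by omega)
      have : (k : ℤ) * t ≤ w + 1 := by exact_mod_cast this
      linarith
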